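/- An integer sequence is a finite sequence of integers. An extension of a sequence $s=(s(1),\dots,s(n))$ is a sequence obtained from $s$ by repeating each entry an arbitrary number of times, at least once. For integer sequences $r,s$, say that $r$ dominates $s$ if there are extensions $r^*$ of $r$ and $s^*$ of $s$ of the same length with $r^*(i)\le s^*(i)$ for all $i$. The set $r\oplus s$ of merges of $r$ and $s$ consists of all entrywise sums $r^*+s^*$, where $r^*$ and $s^*$ are extensions of $r$ and $s$ of the same length. A non-diagonal merge of $r$ (of length $m$) and $c$ (of length $n$) is a sequence $\bigl(r(i_h)+c(j_h)\bigr)_{h=1}^{\ell}$ with $(i_1,j_1)=(1,1)$, $(i_\ell,j_\ell)=(m,n)$, and $(i_{h+1},j_{h+1})\in\{(i_h+1,j_h),\,(i_h,j_h+1)\}$ for all $1\le h<\ell$. Lemma (Merge Dominator Lemma). Let $r$ and $c$ be non-empty integer sequences of lengths $m$ and $n$. There is a merge $t\in r\oplus c$ that dominates every merge of $r$ and $c$; moreover, $t$ can be taken to be a non-diagonal merge. Such a non-diagonal dominating merge can be computed in time $\mathcal O(m+n)$: there are a single program of a unit-cost random access machine (integer variables and arrays; operations $+$, $-$ and comparison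 $\le$) and a constant $K$ such that, for all non-empty $r$ and $c$, the program, given $r$ and $c$ with their lengths, halts after at most $K(m+n)$ steps and outputs such a sequence $t$. -/

import Mathlib

/-! ## Integer sequences: extensions, domination, merges

An integer sequence is a `List ℤ`. -/

/-- `IsExtension e s`: the sequence `e` is a concatenation `s₁ ∘ ⋯ ∘ sₙ`, where the block `sᵢ` has
length at least one and all its entries equal the `i`-th entry of `s`. -/
def IsExtension (e s : List ℤ) : Prop :=
  ∃ blocks : List (List ℤ),
    List.Forall₂ (fun b a => 1 ≤ b.length ∧ ∀ x ∈ b, x = a) blocks s ∧ e = blocks.flatten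

/-- `Dominates r s`: some extension of `r` is entrywise at most some extension of `s` of the same
length (`List.Forall₂` forces equal lengths). -/
def Dominates (r s : List ℤ) : Prop :=
  ∃ r' s' : List ℤ, IsExtension r' r ∧ IsExtension s' s ∧ List.Forall₂ (· ≤ ·) r' s'

/-- The set `r ⊕ s` of all merges of `r` and `s`. -/
def merges (r s : List ℤ) : Set (List ℤ) :=
  {t | ∃ r' s' : List ℤ, IsExtension r' r ∧ IsExtension s' s ∧ r'.length = s'.length ∧
    t = List.zipWith (· + ·) r' s'}

/-- The entry of the merge matrix of `r` and `c` at a (zero-based) index; only used at indices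
inside the matrix. -/
def mergeEntry (r c : List ℤ) (x : ℕ × ℕ) : ℤ :=
  r.getD x.1 0 + c.getD x.2 0

/-- A step that increases exactly one of the two coordinates, by one. -/
def NonDiagStep (x y : ℕ × ℕ) : Prop :=
  y = (x.1 + 1, x.2) ∨ y = (x.1, x.2 + 1)

/-- `IsNonDiagPath m n p`: `p` is a non-diagonal path in an `m × n` matrix, from the first index
`(0, 0)` to the last index `(m - 1, n - 1)`. Indices are zero-based; there is no such path if
`m = 0` or `n = 0`. -/
def IsNonDiagPath (m n : ℕ) (p : List (ℕ × ℕ)) : Prop :=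
  (∀ x ∈ p, x.1 < m ∧ x.2 < n) ∧
  p.head? = some (0, 0) ∧ p.getLast? = some (m - 1, n - 1) ∧ p.IsChain NonDiagStep

/-- The set of all non-diagonal merges of `r` and `c`: the sequences of entries of the merge
matrix along its non-diagonal paths. -/
def nonDiagMerges (r c : List ℤ) : Set (List ℤ) :=
  {t | ∃ p : List (ℕ × ℕ), IsNonDiagPath r.length c.length p ∧ t = p.map (mergeEntry r c)}

/-! ## A unit-cost random access machine with structured control flow

A program is a finite piece of text over integer variables and integer arrays. Its only arithmetic
operations are addition and subtraction and its only test is `≤`; arrays have random access. Every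
operation, every access and every test costs at least one step. -/

namespace RAM

/-- The memory: the variables, and the cells `a[i]` of the arrays. -/
structure State where
  var : ℕ → ℤ
  arr : ℕ → ℤ → ℤ

/-- Expressions: constants, variables, array accesses `a[i]`, sums and differences. -/
inductive Expr where
  | const (k : ℤ)
  | var (x : ℕ)
  | get (a : ℕ) (i : Expr)
  | add (e f : Expr)
  | sub (e f : Expr)

/-- The value of an expression. -/
def Expr.eval (s : State) : Expr → ℤ
  | .const k => k
  | .var x => s.var x
  | .get a i => s.arr a (i.eval s)
  | .add e f => e.eval s + f.eval s
  | .sub e f => e.eval s - f.eval s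

/-- The number of steps that evaluating an expression takes: one for each symbol. -/
def Expr.cost : Expr → ℕ
  | .const _ => 1
  | .var _ => 1
  | .get _ i => i.cost + 1
  | .add e f => e.cost + f.cost + 1
  | .sub e f => e.cost + f.cost + 1

/-- Programs. -/
inductive Prog where
  /-- do nothing -/
  | skip
  /-- `x := e` -/
  | assign (x : ℕ) (e : Expr)
  /-- `a[i] := e` -/
  | store (a : ℕ) (i e : Expr)
  /-- `P; Q` -/
  | seq (P Q : Prog)
  /-- `if e ≤ f then P else Q` -/
  | ite (e f : Expr) (P Q : Prog)
  /-- `while e ≤ f do P` -/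
  | loop (e f : Expr) (P : Prog)

/-- Write the value `v` to the variable `x`. -/
def State.setVar (s : State) (x : ℕ) (v : ℤ) : State :=
  { s with var := Function.update s.var x v }

/-- Write the value `v` to the array cell `a[i]`. -/
def State.setArr (s : State) (a : ℕ) (i v : ℤ) : State :=
  { s with arr := Function.update s.arr a (Function.update (s.arr a) i v) }

/-- `Exec P s k s'`: started in the state `s`, the program `P` halts after exactly `k` steps, in
the state `s'`. -/
inductive Exec : Prog → State → ℕ → State → Prop where
  | skip (s : State) : Exec .skip s 1 s
  | assign (s : State) (x : ℕ) (e : Expr) :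
      Exec (.assign x e) s (e.cost + 1) (s.setVar x (e.eval s))
  | store (s : State) (a : ℕ) (i e : Expr) :
      Exec (.store a i e) s (i.cost + e.cost + 1) (s.setArr a (i.eval s) (e.eval s))
  | seq {P Q : Prog} {s s' s'' : State} {k l : ℕ} (hP : Exec P s k s') (hQ : Exec Q s' l s'') :
      Exec (.seq P Q) s (k + l) s''
  | ite_true {e f : Expr} {P Q : Prog} {s s' : State} {k : ℕ}
      (h : e.eval s ≤ f.eval s) (hP : Exec P s k s') :
      Exec (.ite e f P Q) s (e.cost + f.cost + 1 + k) s'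
  | ite_false {e f : Expr} {P Q : Prog} {s s' : State} {k : ℕ}
      (h : ¬ e.eval s ≤ f.eval s) (hQ : Exec Q s k s') :
      Exec (.ite e f P Q) s (e.cost + f.cost + 1 + k) s'
  | loop_done {e f : Expr} {P : Prog} {s : State} (h : ¬ e.eval s ≤ f.eval s) :
      Exec (.loop e f P) s (e.cost + f.cost + 1) s
  | loop_step {e f : Expr} {P : Prog} {s s' s'' : State} {k l : ℕ}
      (h : e.eval s ≤ f.eval s) (hP : Exec P s k s') (hL : Exec (.loop e f P) s' l s'') :
      Exec (.loop e f P) s (e.cost + f.cost + 1 + k + l) s''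

/-- The initial state on input `r`, `c`: variables `0`, `1` hold the lengths of `r`, `c`, arrays
`0`, `1` hold their entries from index `0` on, and everything else is zero. -/
def input (r c : List ℤ) : State where
  var x := if x = 0 then r.length else if x = 1 then c.length else 0
  arr a i :=
    if i < 0 then 0
    else if a = 0 then r.getD i.toNat 0
    else if a = 1 then c.getD i.toNat 0
    else 0

/-- The state `s` holds the sequence `t` as output: variable `2` holds its length and array `2`
its entries, from index `0` on. -/
def Outputs (s : State) (t : List ℤ) : Prop :=
  s.var 2 = t.length ∧ ∀ (i : ℕ) (h : i < t.length), s.arr 2 i = t[i]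

end RAM

/-! ## Prefix minima and climbs -/

/-! A merge is read off a monotone walk in the merge matrix, with each step raising each coordinate
by at most one, and the value at `(x, y)` is `a x + b y`. Domination is a simultaneous traversal
(`Coupled`) in which either walk may pause, as long as the dominating one never has the larger
value.

Let `p`, `q` be positions of minima of the two sequences. Between `(0, 0)` and `(p, q)` only pairs
of prefix minima matter (ties count, so a later equal entry is again a prefix minimum). At such a
pair `(i, j)` the greedy walk moves the coordinate with the lower barrier before its next prefix
minimum; let `d` be that barrier's height. Any other walk from there must, to go on, raise one
coordinate by at least `d`. Until it does, both its coordinates keep values at least `a i` and `b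
j`. So at the first such moment its value is at least `a i + b j + d`, and the greedy walk can cross
its barrier while the other walk pauses. This is `greedyWalk_coupled`. By reversal, the same holds
between `(p, q)` and the last index, and `domPath` joins the two halves.

A competing walk may miss `(p, q)`. It still meets row `p` and column `q`. At a maximum `Z` of its
values between these two meetings (a hub, `exists_hub`), a detour to `(p, q)` costs no more than the
value at `Z`. Hence each half of `domPath` dominates the corresponding part of the competitor, cut
at `Z`, and the two couplings concatenate (`domPath_coupled`).

For linear time, one scan with a running maximum yields all climbs of a sequence, and each greedy
step compares two stored numbers. Two scans and one walk from each end suffice. -/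

def IsPrefixMin (a : ℕ → ℤ) (i : ℕ) : Prop := ∀ x ≤ i, a i ≤ a x

/-- `D i` is, for every prefix minimum `i < p` of `a`, the height that has to be climbed from `i`
to reach the next prefix minimum, and `-1` strictly between two prefix minima. -/
def IsClimb (a : ℕ → ℤ) (p : ℕ) (D : ℕ → ℤ) : Prop :=
  ∀ i < p, IsPrefixMin a i → ∃ i', i < i' ∧ i' ≤ p ∧ IsPrefixMin a i' ∧
    (∀ x, i < x → x < i' → a i < a x ∧ D x = -1) ∧
    (∀ x, i ≤ x → x ≤ i' → a x ≤ a i + D i) ∧ ∃ z, i ≤ z ∧ z < i' ∧ a z = a i + D i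

lemma IsClimb.nonneg {a : ℕ → ℤ} {p : ℕ} {D : ℕ → ℤ} (hD : IsClimb a p D) {i : ℕ} (hi : i < p)
    (hr : IsPrefixMin a i) : 0 ≤ D i := by
  obtain ⟨i', h1, -, -, -, h2, -⟩ := hD i hi hr
  have := h2 i le_rfl h1.le
  omega

/-- The peak of height `D i` is attained before the next prefix minimum, so a stretch that stays
below the peak ends before it, where all entries exceed `a i`. -/
lemma IsClimb.lt_of_below {a : ℕ → ℤ} {p : ℕ} {D : ℕ → ℤ} (hD : IsClimb a p D) {i : ℕ}
    (hi : i < p) (hr : IsPrefixMin a i) {x : ℕ} (h : ∀ y, i ≤ y → y ≤ x → a y < a i + D i) :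
    x < p ∧ ∀ y, i < y → y ≤ x → a i < a y := by
  obtain ⟨i', h1, h2, -, h3, -, z, hz, hz', h4⟩ := hD i hi hr
  have hx : x < z := by
    by_contra! hc
    have := h z hz hc
    omega
  exact ⟨by omega, fun y hy hy' => (h3 y hy (by omega)).1⟩

lemma IsClimb.le_of_below {a : ℕ → ℤ} {p : ℕ} {D : ℕ → ℤ} (hD : IsClimb a p D) {i : ℕ}
    (hi : i ≤ p) (hr : IsPrefixMin a i) {x : ℕ} (hp : a p ≤ a x) {d : ℤ} (hd : i < p → d ≤ D i)
    (h : ∀ y, i ≤ y → y ≤ x → a y < a i + d) : a i ≤ a x := by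
  rcases le_or_gt x i with hx | hx
  · exact hr x hx
  rcases hi.eq_or_lt with rfl | hi
  · exact hp
  have hd := hd hi
  exact ((hD.lt_of_below hi hr (x := x) fun y h1 h2 => by have := h y h1 h2; omega).2
    x hx le_rfl).le

/-- The next prefix minimum after `i` cannot jump over `p`, because entries strictly in between are
larger than `a i`. -/
lemma IsClimb.mono {a : ℕ → ℤ} {p l : ℕ} {D : ℕ → ℤ} (hD : IsClimb a l D) (hp : p ≤ l)
    (hr : IsPrefixMin a p) : IsClimb a p D := by
  intro i hi hri
  obtain ⟨i', h1, h2, h3, h4, h5⟩ := hD i (by omega) hri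
  refine ⟨i', h1, ?_, h3, h4, h5⟩
  by_contra! hc
  have := (h4 p hi hc).1
  have := hr i hi.le
  omega

/-! ## The greedy walk -/

/-- One step of the greedy walk towards `(p, q)`: advance the coordinate with the smaller climb. -/
def walkStep (D E : ℕ → ℤ) (p q : ℕ) (u : ℕ × ℕ) : ℕ × ℕ :=
  if u.1 < p ∧ (q ≤ u.2 ∨ D u.1 ≤ E u.2) then (u.1 + 1, u.2) else (u.1, u.2 + 1)

/-- The walk needs no memory of which coordinate it is moving: between two prefix minima the stored
climb is `-1`, below every genuine climb, so a coordinate once started goes on to its next prefix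
minimum. -/
def greedyWalk (D E : ℕ → ℤ) (p q : ℕ) (k : ℕ) : ℕ × ℕ :=
  (walkStep D E p q)^[k] (0, 0)

section walk

variable {D E : ℕ → ℤ} {p q : ℕ}

lemma greedyWalk_succ (k : ℕ) :
    greedyWalk D E p q (k + 1) = walkStep D E p q (greedyWalk D E p q k) :=
  Function.iterate_succ_apply' _ _ _

lemma greedyWalk_bounds {k : ℕ} (hk : k ≤ p + q) :
    (greedyWalk D E p q k).1 ≤ p ∧ (greedyWalk D E p q k).2 ≤ q ∧
      (greedyWalk D E p q k).1 + (greedyWalk D E p q k).2 = k := by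
  induction k with
  | zero => simp [greedyWalk]
  | succ k ih =>
    have := ih (by omega)
    rw [greedyWalk_succ, walkStep]
    split_ifs with h <;> simp only
    · omega
    · omega

lemma greedyWalk_last : greedyWalk D E p q (p + q) = (p, q) := by
  have := greedyWalk_bounds (D := D) (E := E) (le_refl (p + q))
  ext <;> simp only <;> omega

lemma greedyWalk_nonDiagStep (k : ℕ) :
    NonDiagStep (greedyWalk D E p q k) (greedyWalk D E p q (k + 1)) := by
  rw [greedyWalk_succ, walkStep]
  split_ifs
  · exact Or.inl rfl
  · exact Or.inr rfl

end walk

/-! ## Couplings -/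

/-- A step of a simultaneous traversal of `f` and `g` that keeps `f` below `g`. -/
def CoupleStep (f g : ℕ → ℤ) (u v : ℕ × ℕ) : Prop :=
  (v.1 = u.1 ∨ v.1 = u.1 + 1) ∧ (v.2 = u.2 ∨ v.2 = u.2 + 1) ∧ f u.1 ≤ g u.2 ∧ f v.1 ≤ g v.2

abbrev Coupled (f g : ℕ → ℤ) : ℕ × ℕ → ℕ × ℕ → Prop := Relation.ReflTransGen (CoupleStep f g)

lemma Coupled.run {f g : ℕ → ℤ} {k n : ℕ} (l : ℕ) (h : ∀ s ≤ l, f (k + s) ≤ g n) :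
    Coupled f g (k, n) (k + l, n) := by
  induction l with
  | zero => exact .refl
  | succ l ih =>
    exact (ih fun s hs => h s (by omega)).tail
      ⟨Or.inr rfl, Or.inl rfl, h l (by omega), h (l + 1) le_rfl⟩

lemma Coupled.congr_left {f f' g : ℕ → ℤ} {K : ℕ} (hf : ∀ k ≤ K, f' k = f k) {u v : ℕ × ℕ}
    (h : Coupled f' g u v) (hv : v.1 ≤ K) : Coupled f g u v := by
  induction h with
  | refl => exact .refl
  | tail _ h ih =>
    obtain ⟨h1, h2, h3, h4⟩ := h
    rw [hf _ (by omega)] at h3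
    rw [hf _ hv] at h4
    exact (ih (by omega)).tail ⟨h1, h2, h3, h4⟩

lemma Coupled.reverse {f g f' g' : ℕ → ℤ} {K N : ℕ} (hf : ∀ k, f' k = f (K - k))
    (hg : ∀ n, g' n = g (N - n)) {u v : ℕ × ℕ} (h : Coupled f' g' u v) :
    Coupled f g (K - v.1, N - v.2) (K - u.1, N - u.2) := by
  induction h with
  | refl => exact .refl
  | tail _ h ih =>
    refine .head ?_ ih
    obtain ⟨h1, h2, h3, h4⟩ := h
    rw [hf, hg] at h3 h4
    exact ⟨by dsimp only; omega, by dsimp only; omega, h4, h3⟩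

/-- While the competitor runs beyond `Z`, its values are at most `g Z`, so it may as well pause at
`Z`. -/
lemma Coupled.clip {f g g' : ℕ → ℤ} {Z : ℕ} (hg : ∀ n ≤ Z, g' n = g n)
    (hg' : ∀ n > Z, g' n ≤ g Z) {u v : ℕ × ℕ} (h : Coupled f g' u v) :
    Coupled f g (u.1, min u.2 Z) (v.1, min v.2 Z) := by
  have key : ∀ n, g' n ≤ g (min n Z) := by
    intro n
    rcases le_or_gt n Z with h | h
    · rw [min_eq_left h, hg n h]
    · rw [min_eq_right h.le]; exact hg' n h
  refine h.lift (fun w => (w.1, min w.2 Z)) fun u v ⟨h1, h2, h3, h4⟩ => ?_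
  exact ⟨h1, by dsimp only; omega, h3.trans (key _), h4.trans (key _)⟩

/-! ## The greedy walk dominates every walk from `(0, 0)` to `(p, q)` -/

section left

variable {a b : ℕ → ℤ} {D E : ℕ → ℤ} {p q : ℕ}

/-- The barrier that the greedy walk faces at a pair of prefix minima: the climb of the coordinate
that `walkStep` would advance. -/
def nextClimb (D E : ℕ → ℤ) (p q i j : ℕ) : ℤ :=
  if i < p ∧ (q ≤ j ∨ D i ≤ E j) then D i else E j

lemma nextClimb_le_left {i j : ℕ} (hi : i < p) :
    nextClimb D E p q i j ≤ D i := by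
  unfold nextClimb
  split_ifs <;> omega

lemma nextClimb_le_right {i j : ℕ} (hj : j < q) :
    nextClimb D E p q i j ≤ E j := by
  unfold nextClimb
  split_ifs <;> omega

lemma nextClimb_nonneg (hD : IsClimb a p D) (hE : IsClimb b q E) {i j : ℕ}
    (hi : i ≤ p) (hj : j ≤ q) (ri : IsPrefixMin a i) (rj : IsPrefixMin b j)
    (h : i < p ∨ j < q) : 0 ≤ nextClimb D E p q i j := by
  unfold nextClimb
  split_ifs with hc
  · exact hD.nonneg hc.1 ri
  · exact hE.nonneg (by omega) rj

lemma greedyWalk_run_left (hE : IsClimb b q E) {i j k : ℕ} (hj : j ≤ q)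
    (rj : IsPrefixMin b j) (hW : greedyWalk D E p q k = (i, j)) {i' : ℕ} (hi' : i' ≤ p)
    (hneg : ∀ x, i < x → x < i' → D x = -1) (hc : q ≤ j ∨ D i ≤ E j) (s : ℕ) (hs : i + s ≤ i') :
    greedyWalk D E p q (k + s) = (i + s, j) := by
  induction s with
  | zero => exact hW
  | succ s ih =>
    rw [← add_assoc, greedyWalk_succ, ih (by omega), walkStep, if_pos]
    · rfl
    refine ⟨by dsimp only; omega, ?_⟩
    dsimp only
    rcases Nat.eq_zero_or_pos s with rfl | h
    · exact hc
    · rcases hj.eq_or_lt with h' | h'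
      · omega
      · have := hE.nonneg h' rj
        have := hneg (i + s) (by omega) (by omega)
        omega

lemma greedyWalk_run_right (hD : IsClimb a p D) {i j k : ℕ}
    (ri : IsPrefixMin a i) (hW : greedyWalk D E p q k = (i, j)) {j' : ℕ} (hj' : j' ≤ q)
    (hneg : ∀ y, j < y → y < j' → E y = -1) (hc : ¬ (i < p ∧ (q ≤ j ∨ D i ≤ E j))) (s : ℕ)
    (hs : j + s ≤ j') :
    greedyWalk D E p q (k + s) = (i, j + s) := by
  induction s with
  | zero => exact hW
  | succ s ih =>
    rw [← add_assoc, greedyWalk_succ, ih (by omega), walkStep, if_neg]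
    · rfl
    dsimp only
    rcases Nat.eq_zero_or_pos s with rfl | h
    · exact hc
    · rintro ⟨h1, h2⟩
      have := hD.nonneg h1 ri
      have := hneg (j + s) (by omega) (by omega)
      omega

/-- The greedy walk, at the pair `(i, j)` of prefix minima, waits: the other walk, at `(x, y)`,
has not yet climbed high enough. -/
structure Waits (a b : ℕ → ℤ) (D E : ℕ → ℤ) (p q i j x y : ℕ) : Prop where
  hi : i ≤ p
  hj : j ≤ q
  ri : IsPrefixMin a i
  rj : IsPrefixMin b j
  low : i < p ∨ j < q → (∀ z, i ≤ z → z ≤ x → a z < a i + nextClimb D E p q i j) ∧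
    ∀ z, j ≤ z → z ≤ y → b z < b j + nextClimb D E p q i j

/-- With the competitor frozen at `(x, y)`, the greedy walk crosses every barrier that fits below `g
n` and stops at the first that does not. The number `r` bounds the steps left to `(p, q)`. The last
two hypotheses say that the competitor has not passed the next prefix minimum in either coordinate.
-/
lemma exists_waits (hD : IsClimb a p D) (hE : IsClimb b q E) {f g : ℕ → ℤ}
    (hf : ∀ k, f k = a (greedyWalk D E p q k).1 + b (greedyWalk D E p q k).2)
    {n x y : ℕ} (hg : g n = a x + b y) (r : ℕ) :
    ∀ i j : ℕ, i ≤ p → j ≤ q → p + q ≤ i + j + r → IsPrefixMin a i → IsPrefixMin b j →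
      greedyWalk D E p q (i + j) = (i, j) → a i + b j ≤ g n →
      (∀ z, i ≤ z → z ≤ x → a z + b j ≤ g n) → (∀ z, j ≤ z → z ≤ y → a i + b z ≤ g n) →
      (i < p → ∀ z, i < z → z < x → a i < a z) → (j < q → ∀ z, j < z → z < y → b j < b z) →
      ∃ i' j', Coupled f g (i + j, n) (i' + j', n) ∧ f (i' + j') ≤ g n ∧
        greedyWalk D E p q (i' + j') = (i', j') ∧
        Waits a b D E p q i' j' x y := by
  induction r with
  | zero =>
    intro i j hi hj hr ri rj hW h0 h1 h2 h3 h4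
    exact ⟨i, j, .refl, by rw [hf, hW]; exact h0, hW, hi, hj, ri, rj, fun h => by omega⟩
  | succ r ih =>
    intro i j hi hj hr ri rj hW h0 h1 h2 h3 h4
    rcases lt_or_ge (g n) (a i + b j + nextClimb D E p q i j) with hL | hL
    · refine ⟨i, j, .refl, by rw [hf, hW]; exact h0, hW, hi, hj, ri, rj, fun h => ⟨?_, ?_⟩⟩
      · intro z hz hz'
        have := h1 z hz hz'
        omega
      · intro z hz hz'
        have := h2 z hz hz'
        omega
    by_cases hc : i < p ∧ (q ≤ j ∨ D i ≤ E j)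
    · rw [nextClimb, if_pos hc] at hL
      obtain ⟨i', hii, hip, ri', hb, hpk, -⟩ := hD i hc.1 ri
      have hrun := greedyWalk_run_left hE hj rj hW hip (fun x h h' => (hb x h h').2) hc.2
      have hlow : ∀ s ≤ i' - i, f (i + j + s) ≤ g n := by
        intro s hs
        rw [hf, hrun s (by omega)]
        have := hpk (i + s) (by omega) (by omega)
        dsimp only
        omega
      have hle := ri' i hii.le
      -- Otherwise `i'` lies strictly between `i` and `x`, so `a i < a i'`, although `i'` is a
      -- prefix minimum.
      have hx : x ≤ i' := by
        by_contra! hx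
        have := h3 hc.1 i' hii hx
        omega
      have hend := hrun (i' - i) (by omega)
      rw [show i + (i' - i) = i' by omega, show i + j + (i' - i) = i' + j by omega] at hend
      have hc1 := Coupled.run _ hlow
      rw [show i + j + (i' - i) = i' + j by omega] at hc1
      obtain ⟨i'', j'', c1, c2, c3, c4⟩ := ih i' j hip hj (by omega) ri' rj hend
        (by omega) (fun z hz hz' => h1 z (by omega) hz')
        (fun z hz hz' => by have := h2 z hz hz'; omega) (fun _ z hz hz' => by omega) h4
      exact ⟨i'', j'', hc1.trans c1, c2, c3, c4⟩
    · rw [nextClimb, if_neg hc] at hL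
      rcases hj.eq_or_lt with hj' | hj'
      · have : i = p := by omega
        exact ⟨i, j, .refl, by rw [hf, hW]; exact h0, hW, hi, hj, ri, rj, fun h => by omega⟩
      obtain ⟨j', hjj, hjq, rj', hb, hpk, -⟩ := hE j hj' rj
      have hrun := greedyWalk_run_right hD ri hW hjq (fun x h h' => (hb x h h').2) hc
      have hlow : ∀ s ≤ j' - j, f (i + j + s) ≤ g n := by
        intro s hs
        rw [hf, hrun s (by omega)]
        have := hpk (j + s) (by omega) (by omega)
        dsimp only
        omega
      have hle := rj' j hjj.le
      have hy : y ≤ j' := by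
        by_contra! hy
        have := h4 hj' j' hjj hy
        omega
      have hend := hrun (j' - j) (by omega)
      rw [show j + (j' - j) = j' by omega, show i + j + (j' - j) = i + j' by omega] at hend
      have hc1 := Coupled.run _ hlow
      rw [show i + j + (j' - j) = i + j' by omega] at hc1
      obtain ⟨i'', j'', c1, c2, c3, c4⟩ := ih i j' hi hjq (by omega) ri rj' hend
        (by omega) (fun z hz hz' => by have := h1 z hz hz'; omega)
        (fun z hz hz' => h2 z (by omega) hz') h3 (fun _ z hz hz' => by omega)
      exact ⟨i'', j'', hc1.trans c1, c2, c3, c4⟩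

/-- The invariant is that after each competitor step the greedy walk waits before a barrier that the
competitor has not reached in either coordinate. The competitor's coordinates need only rise by at
most one per step; arbitrary drops are allowed, which the detours from a hub exploit. -/
theorem greedyWalk_coupled (hD : IsClimb a p D) (hE : IsClimb b q E) {f g : ℕ → ℤ}
    (hf : ∀ k, f k = a (greedyWalk D E p q k).1 + b (greedyWalk D E p q k).2)
    {X Y : ℕ → ℕ} (hg : ∀ n, g n = a (X n) + b (Y n)) (hX0 : X 0 = 0) (hY0 : Y 0 = 0)
    {N : ℕ} (hXN : X N = p) (hYN : Y N = q) (hX : ∀ n < N, X (n + 1) ≤ X n + 1)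
    (hY : ∀ n < N, Y (n + 1) ≤ Y n + 1) (hp : ∀ n ≤ N, a p ≤ a (X n))
    (hq : ∀ n ≤ N, b q ≤ b (Y n)) : Coupled f g (0, 0) (p + q, N) := by
  have key : ∀ n ≤ N, ∃ i j, Coupled f g (0, 0) (i + j, n) ∧ f (i + j) ≤ g n ∧
      greedyWalk D E p q (i + j) = (i, j) ∧ Waits a b D E p q i j (X n) (Y n) := by
    intro n
    induction n with
    | zero =>
      intro _
      refine exists_waits hD hE hf (hg 0) (p + q) 0 0 (by omega) (by omega) (by omega) ?_ ?_ rfl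
        ?_ ?_ ?_ ?_ ?_
      · intro x hx; rw [Nat.le_zero.1 hx]
      · intro x hx; rw [Nat.le_zero.1 hx]
      · rw [hg, hX0, hY0]
      · intro z _ hz; rw [hX0] at hz; rw [hg, hX0, hY0, Nat.le_zero.1 hz]
      · intro z _ hz; rw [hY0] at hz; rw [hg, hX0, hY0, Nat.le_zero.1 hz]
      · intro _ z _ hz; omega
      · intro _ z _ hz; omega
    | succ n ih =>
      intro hn
      obtain ⟨i, j, c1, c2, c3, hi, hj, ri, rj, low⟩ := ih (by omega)
      have hX := hX n (by omega)
      have hY := hY n (by omega)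
      have hp' := hp (n + 1) hn
      have hq' := hq (n + 1) hn
      have hfk : f (i + j) = a i + b j := by rw [hf, c3]
      by_cases hdone : i < p ∨ j < q
      swap
      · obtain ⟨rfl, rfl⟩ : i = p ∧ j = q := by omega
        have hle : f (i + j) ≤ g (n + 1) := by rw [hfk, hg]; omega
        exact ⟨i, j, c1.tail ⟨Or.inl rfl, Or.inr rfl, c2, hle⟩, hle, c3, hi, hj, ri, rj,
          fun h => by omega⟩
      obtain ⟨lx, ly⟩ := low hdone
      have hd0 := nextClimb_nonneg hD hE hi hj ri rj hdone
      have hdx : i < p → nextClimb D E p q i j ≤ D i := nextClimb_le_left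
      have hdy : j < q → nextClimb D E p q i j ≤ E j := nextClimb_le_right
      set d := nextClimb D E p q i j with hd
      -- Below the barrier the row has not passed beyond the stretch above `a i`; at or above the
      -- barrier there is nothing to show, since `d` is nonnegative.
      have hax : a i ≤ a (X (n + 1)) := by
        by_cases h : a (X (n + 1)) < a i + d
        · refine hD.le_of_below hi ri hp' hdx fun z hz hz' => ?_
          rcases hz'.eq_or_lt with rfl | hz'
          · exact h
          · exact lx z hz (by omega)
        · omega
      have hby : b j ≤ b (Y (n + 1)) := by
        by_cases h : b (Y (n + 1)) < b j + d
        · refine hE.le_of_below hj rj hq' hdy fun z hz hz' => ?_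
          rcases hz'.eq_or_lt with rfl | hz'
          · exact h
          · exact ly z hz (by omega)
        · omega
      have hgn := hg (n + 1)
      have hle : f (i + j) ≤ g (n + 1) := by rw [hfk, hgn]; omega
      have c1' := c1.tail (c := (i + j, n + 1)) ⟨Or.inl rfl, Or.inr rfl, c2, hle⟩
      by_cases hw : (∀ z, i ≤ z → z ≤ X (n + 1) → a z < a i + d) ∧
          ∀ z, j ≤ z → z ≤ Y (n + 1) → b z < b j + d
      · exact ⟨i, j, c1', hle, c3, hi, hj, ri, rj, fun _ => hw⟩
      -- Some coordinate has just risen by at least `d`, and the other one is still at least its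
      -- prefix minimum.
      have hL : a i + b j + d ≤ g (n + 1) := by
        by_contra! hL
        refine hw ⟨fun z hz hz' => ?_, fun z hz hz' => ?_⟩
        · rcases hz'.eq_or_lt with rfl | hz'
          · omega
          · exact lx z hz (by omega)
        · rcases hz'.eq_or_lt with rfl | hz'
          · omega
          · exact ly z hz (by omega)
      obtain ⟨i', j', e1, e2⟩ := exists_waits hD hE hf hgn (p + q) i j hi hj (by omega) ri rj
        c3 (by omega)
        (fun z hz hz' => by
          rcases hz'.eq_or_lt with rfl | hz'
          · omega
          · have := lx z hz (by omega)
            omega)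
        (fun z hz hz' => by
          rcases hz'.eq_or_lt with rfl | hz'
          · omega
          · have := ly z hz (by omega)
            omega)
        (fun h z hz hz' => (hD.lt_of_below h ri (x := z) fun w hw hw' => by
          have := lx w hw (by omega)
          have := hdx h
          omega).2 z hz le_rfl)
        (fun h z hz hz' => (hE.lt_of_below h rj (x := z) fun w hw hw' => by
          have := ly w hw (by omega)
          have := hdy h
          omega).2 z hz le_rfl)
      exact ⟨i', j', c1'.trans e1, e2⟩
  obtain ⟨i, j, c1, -, c3, hi, hj, ri, rj, low⟩ := key N le_rfl
  -- A competitor standing at `(p, q)` has passed every barrier, so the greedy walk cannot be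
  -- waiting.
  have hij : ¬ (i < p ∨ j < q) := by
    intro hdone
    obtain ⟨lx, ly⟩ := low hdone
    rw [hXN] at lx
    rw [hYN] at ly
    rcases hdone with h | h
    · have := (hD.lt_of_below h ri (x := p) fun w hw hw' => by
        have := lx w hw hw'
        have := nextClimb_le_left (D := D) (E := E) (q := q) (j := j) h
        omega).1
      omega
    · have := (hE.lt_of_below h rj (x := q) fun w hw hw' => by
        have := ly w hw hw'
        have := nextClimb_le_right (D := D) (E := E) (p := p) (i := i) h
        omega).1
      omega
  obtain ⟨rfl, rfl⟩ : i = p ∧ j = q := by omega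
  exact c1

end left

/-! ## Splitting a walk through the matrix at a hub -/

lemma exists_visit {X : ℕ → ℕ} {A B w : ℕ} (hX : ∀ n, X (n + 1) ≤ X n + 1) (hAB : A ≤ B)
    (hA : X A ≤ w) (hB : w ≤ X B) : ∃ n, A ≤ n ∧ n ≤ B ∧ X n = w := by
  induction B, hAB using Nat.le_induction with
  | base => exact ⟨A, le_rfl, le_rfl, by omega⟩
  | succ B hAB ih =>
    have := hX B
    rcases lt_or_ge (X B) w with h | h
    · exact ⟨B + 1, by omega, le_rfl, by omega⟩
    · obtain ⟨n, h1, h2, h3⟩ := ih h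
      exact ⟨n, h1, by omega, h3⟩

/-- From the position `(x, y)` one can get to `(p, q)` without exceeding the value `v`, through
row `p` or column `q`, from either side. -/
structure IsHub (a b : ℕ → ℤ) (p q x y : ℕ) (v : ℤ) : Prop where
  row : ∀ z, p ≤ z ∧ z ≤ x ∨ x ≤ z ∧ z ≤ p → a z + b q ≤ v
  col : ∀ z, q ≤ z ∧ z ≤ y ∨ y ≤ z ∧ z ≤ q → a p + b z ≤ v
  ge : p ≤ x ∨ q ≤ y
  le : x ≤ p ∨ y ≤ q

lemma IsHub.swap {a b : ℕ → ℤ} {p q x y : ℕ} {v : ℤ} (h : IsHub a b p q x y v) :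
    IsHub b a q p y x v where
  row z hz := by have := h.col z hz; omega
  col z hz := by have := h.row z hz; omega
  ge := h.ge.symm
  le := h.le.symm

section hub

variable {a b : ℕ → ℤ} {p q : ℕ} {X Y : ℕ → ℕ} {N : ℕ}

/-- Take `Z` with maximal value between the visit to row `p` and the visit to column `q`. Every row
between `p` and `X Z` is visited in that interval, and replacing the column there by the minimum `q`
only lowers the value; likewise for columns. -/
lemma exists_hub_of_le (hX : ∀ n, X n ≤ X (n + 1) ∧ X (n + 1) ≤ X n + 1)
    (hY : ∀ n, Y n ≤ Y (n + 1) ∧ Y (n + 1) ≤ Y n + 1) (hp : ∀ n ≤ N, a p ≤ a (X n))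
    (hq : ∀ n ≤ N, b q ≤ b (Y n)) {A B : ℕ} (hAB : A ≤ B) (hB : B ≤ N) (hXA : X A = p)
    (hYB : Y B = q) : ∃ Z ≤ N, IsHub a b p q (X Z) (Y Z) (a (X Z) + b (Y Z)) := by
  have mX := monotone_nat_of_le_succ fun n => (hX n).1
  have mY := monotone_nat_of_le_succ fun n => (hY n).1
  obtain ⟨Z, hZ, hmax⟩ := Finset.exists_max_image (Finset.Icc A B) (fun n => a (X n) + b (Y n))
    ⟨A, by simp [hAB]⟩
  rw [Finset.mem_Icc] at hZ
  have hXZ : p ≤ X Z := hXA ▸ mX hZ.1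
  have hYZ : Y Z ≤ q := hYB ▸ mY hZ.2
  refine ⟨Z, by omega, fun z hz => ?_, fun z hz => ?_, Or.inl hXZ, Or.inr hYZ⟩
  · obtain ⟨n, h1, h2, rfl⟩ := exists_visit (w := z) (fun n => (hX n).2) hZ.1 (by omega) (by omega)
    have := hmax n (Finset.mem_Icc.2 ⟨h1, by omega⟩)
    have := hq n (by omega)
    omega
  · obtain ⟨n, h1, h2, rfl⟩ := exists_visit (w := z) (fun n => (hY n).2) hZ.2 (by omega) (by omega)
    have := hmax n (Finset.mem_Icc.2 ⟨by omega, h2⟩)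
    have := hp n (by omega)
    omega

lemma exists_hub (hX : ∀ n, X n ≤ X (n + 1) ∧ X (n + 1) ≤ X n + 1)
    (hY : ∀ n, Y n ≤ Y (n + 1) ∧ Y (n + 1) ≤ Y n + 1) (hp : ∀ n ≤ N, a p ≤ a (X n))
    (hq : ∀ n ≤ N, b q ≤ b (Y n)) (hX0 : X 0 = 0) (hY0 : Y 0 = 0) (hXN : p ≤ X N)
    (hYN : q ≤ Y N) : ∃ Z ≤ N, IsHub a b p q (X Z) (Y Z) (a (X Z) + b (Y Z)) := by
  obtain ⟨A, -, hA, hXA⟩ := exists_visit (fun n => (hX n).2) (Nat.zero_le N) (by omega) hXN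
  obtain ⟨B, -, hB, hYB⟩ := exists_visit (fun n => (hY n).2) (Nat.zero_le N) (by omega) hYN
  rcases le_total A B with h | h
  · exact exists_hub_of_le hX hY hp hq h hB hXA hYB
  · obtain ⟨Z, hZ, hub⟩ := exists_hub_of_le hY hX hq hp h hA hYB hXA
    exact ⟨Z, hZ, by rw [add_comm]; exact hub.swap⟩

variable {D E : ℕ → ℤ} {Z : ℕ}

lemma greedyWalk_coupled_hub (hD : IsClimb a p D) (hE : IsClimb b q E) {f g : ℕ → ℤ}
    (hf : ∀ k, f k = a (greedyWalk D E p q k).1 + b (greedyWalk D E p q k).2)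
    (hg : ∀ n ≤ Z, g n = a (X n) + b (Y n)) (hX0 : X 0 = 0) (hY0 : Y 0 = 0)
    (hX : ∀ n < Z, X (n + 1) ≤ X n + 1) (hY : ∀ n < Z, Y (n + 1) ≤ Y n + 1)
    (hpmin : ∀ x ≤ p, a p ≤ a x) (hqmin : ∀ y ≤ q, b q ≤ b y)
    (hp : ∀ n ≤ Z, a p ≤ a (X n)) (hq : ∀ n ≤ Z, b q ≤ b (Y n))
    (hub : IsHub a b p q (X Z) (Y Z) (g Z)) : Coupled f g (0, 0) (p + q, Z) := by
  -- After time `Z` the walk is rerouted: a coordinate that is already past its target drops onto it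
  -- at once, while the other drops or advances by single steps to its own target. The hub bounds
  -- keep the values at most `g Z`, and `M` leaves time to arrive.
  obtain ⟨X', Y', M, hM, hX', hY', hXM, hYM, hX1, hY1, hv⟩ : ∃ (X' Y' : ℕ → ℕ) (M : ℕ), Z ≤ M ∧
      (∀ n ≤ Z, X' n = X n) ∧ (∀ n ≤ Z, Y' n = Y n) ∧ X' M = p ∧ Y' M = q ∧
      (∀ n ≥ Z, X' (n + 1) ≤ X' n + 1) ∧ (∀ n ≥ Z, Y' (n + 1) ≤ Y' n + 1) ∧
      ∀ n > Z, X' n ≤ p ∧ Y' n ≤ q ∧ a (X' n) + b (Y' n) ≤ g Z := by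
    rcases hub.ge with h | h
    · refine ⟨fun n => if n ≤ Z then X n else p,
        fun n => if n ≤ Z then Y n else min q (Y Z + (n - Z)), Z + q + 1, by omega,
        fun n hn => if_pos hn, fun n hn => if_pos hn, if_neg (by omega), ?_, ?_, ?_, ?_⟩
      · dsimp only
        rw [if_neg (by omega)]
        omega
      · intro n hn
        dsimp only
        rcases hn.eq_or_lt with rfl | hn
        · rw [if_neg (by omega), if_pos le_rfl]; omega
        · rw [if_neg (by omega), if_neg (by omega)]; omega
      · intro n hn
        dsimp only
        rcases hn.eq_or_lt with rfl | hn
        · rw [if_neg (by omega), if_pos le_rfl]; omega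
        · rw [if_neg (by omega), if_neg (by omega)]; omega
      · intro n hn
        simp only [if_neg (not_le.2 hn)]
        exact ⟨le_rfl, min_le_left _ _, hub.col _ (by omega)⟩
    · refine ⟨fun n => if n ≤ Z then X n else min p (X Z + (n - Z)),
        fun n => if n ≤ Z then Y n else q, Z + p + 1, by omega,
        fun n hn => if_pos hn, fun n hn => if_pos hn, ?_, if_neg (by omega), ?_, ?_, ?_⟩
      · dsimp only
        rw [if_neg (by omega)]
        omega
      · intro n hn
        dsimp only
        rcases hn.eq_or_lt with rfl | hn
        · rw [if_neg (by omega), if_pos le_rfl]; omega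
        · rw [if_neg (by omega), if_neg (by omega)]; omega
      · intro n hn
        dsimp only
        rcases hn.eq_or_lt with rfl | hn
        · rw [if_neg (by omega), if_pos le_rfl]; omega
        · rw [if_neg (by omega), if_neg (by omega)]; omega
      · intro n hn
        simp only [if_neg (not_le.2 hn)]
        exact ⟨min_le_left _ _, le_rfl, hub.row _ (by omega)⟩
  have h := greedyWalk_coupled hD hE (f := f) (g := fun n => a (X' n) + b (Y' n)) hf
    (fun _ => rfl) (by rw [hX' 0 (by omega), hX0]) (by rw [hY' 0 (by omega), hY0]) hXM hYM
    (fun n _ => by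
      rcases lt_or_ge n Z with h | h
      · rw [hX' n h.le, hX' (n + 1) h]; exact hX n h
      · exact hX1 n h)
    (fun n _ => by
      rcases lt_or_ge n Z with h | h
      · rw [hY' n h.le, hY' (n + 1) h]; exact hY n h
      · exact hY1 n h)
    (fun n _ => by
      rcases le_or_gt n Z with h | h
      · rw [hX' n h]; exact hp n h
      · exact hpmin _ (hv n h).1)
    (fun n _ => by
      rcases le_or_gt n Z with h | h
      · rw [hY' n h]; exact hq n h
      · exact hqmin _ (hv n h).2.1)
  have h := h.clip (g := g) (Z := Z) (fun n hn => by rw [hX' n hn, hY' n hn, hg n hn])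
    (fun n hn => (hv n hn).2.2)
  simpa [min_eq_right hM] using h

end hub

/-! ## The dominating path -/

section path

/-- The greedy walk from the first index of an `(m + 1) × (n + 1)` matrix to `(p, q)`, followed by
the reversal of the greedy walk from the last index to `(p, q)`. -/
def domPath (D E D' E' : ℕ → ℤ) (m n p q : ℕ) (k : ℕ) : ℕ × ℕ :=
  if k ≤ p + q then greedyWalk D E p q k
  else (m - (greedyWalk D' E' (m - p) (n - q) (m + n - k)).1,
    n - (greedyWalk D' E' (m - p) (n - q) (m + n - k)).2)

variable {D E D' E' : ℕ → ℤ} {m n p q : ℕ}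

/-- Both halves are at `(p, q)` at time `p + q`, so the second formula is valid there too. -/
lemma domPath_of_ge (hp : p ≤ m) (hq : q ≤ n) {k : ℕ} (hk : p + q ≤ k) :
    domPath D E D' E' m n p q k =
      (m - (greedyWalk D' E' (m - p) (n - q) (m + n - k)).1,
        n - (greedyWalk D' E' (m - p) (n - q) (m + n - k)).2) := by
  rcases hk.eq_or_lt with rfl | hk
  · rw [domPath, if_pos le_rfl, show m + n - (p + q) = (m - p) + (n - q) by omega,
      greedyWalk_last, greedyWalk_last]
    ext <;> dsimp only <;> omega
  · rw [domPath, if_neg (by omega)]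

lemma domPath_bounds (hp : p ≤ m) (hq : q ≤ n) {k : ℕ} (hk : k ≤ m + n) :
    (domPath D E D' E' m n p q k).1 ≤ m ∧ (domPath D E D' E' m n p q k).2 ≤ n ∧
      (domPath D E D' E' m n p q k).1 + (domPath D E D' E' m n p q k).2 = k := by
  rcases le_total k (p + q) with h | h
  · rw [domPath, if_pos h]
    have := greedyWalk_bounds (D := D) (E := E) h
    omega
  · rw [domPath_of_ge hp hq h]
    have := greedyWalk_bounds (D := D') (E := E') (p := m - p) (q := n - q) (k := m + n - k)
      (by omega)
    dsimp only
    omega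

lemma domPath_nonDiagStep (hp : p ≤ m) (hq : q ≤ n) {k : ℕ} (hk : k < m + n) :
    NonDiagStep (domPath D E D' E' m n p q k) (domPath D E D' E' m n p q (k + 1)) := by
  rcases lt_or_ge k (p + q) with h | h
  · rw [domPath, domPath, if_pos h.le, if_pos (Nat.succ_le_of_lt h)]
    exact greedyWalk_nonDiagStep k
  · rw [domPath_of_ge hp hq h, domPath_of_ge hp hq (by omega)]
    have h1 := greedyWalk_bounds (D := D') (E := E') (p := m - p) (q := n - q) (k := m + n - k)
      (by omega)
    have h2 := greedyWalk_nonDiagStep (D := D') (E := E') (p := m - p) (q := n - q)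
      (m + n - (k + 1))
    rw [show m + n - (k + 1) + 1 = m + n - k by omega] at h2
    rcases h2 with h2 | h2
    · left
      rw [h2] at h1 ⊢
      dsimp only at h1 ⊢
      ext <;> dsimp only
      omega
    · right
      rw [h2] at h1 ⊢
      dsimp only at h1 ⊢
      ext <;> dsimp only
      omega

theorem domPath_coupled {a b : ℕ → ℤ} (hp : p ≤ m) (hq : q ≤ n) (hpm : ∀ x ≤ m, a p ≤ a x)
    (hqm : ∀ y ≤ n, b q ≤ b y) (hD : IsClimb a p D) (hE : IsClimb b q E)
    (hD' : IsClimb (fun x => a (m - x)) (m - p) D') (hE' : IsClimb (fun y => b (n - y)) (n - q) E')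
    {X Y : ℕ → ℕ} {N : ℕ} (hX : ∀ i, X i ≤ X (i + 1) ∧ X (i + 1) ≤ X i + 1)
    (hY : ∀ i, Y i ≤ Y (i + 1) ∧ Y (i + 1) ≤ Y i + 1)
    (hX0 : X 0 = 0) (hY0 : Y 0 = 0) (hXN : X N = m) (hYN : Y N = n)
    {f g : ℕ → ℤ} (hf : ∀ k ≤ m + n,
      f k = a (domPath D E D' E' m n p q k).1 + b (domPath D E D' E' m n p q k).2)
    (hg : ∀ i ≤ N, g i = a (X i) + b (Y i)) : Coupled f g (0, 0) (m + n, N) := by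
  have hmX := monotone_nat_of_le_succ fun n => (hX n).1
  have hmY := monotone_nat_of_le_succ fun n => (hY n).1
  have hXm : ∀ i ≤ N, X i ≤ m := fun i hi => hXN ▸ hmX hi
  have hYn : ∀ i ≤ N, Y i ≤ n := fun i hi => hYN ▸ hmY hi
  obtain ⟨Z, hZ, hub⟩ := exists_hub hX hY (fun i hi => hpm _ (hXm i hi))
    (fun i hi => hqm _ (hYn i hi)) hX0 hY0 (hXN ▸ hp) (hYN ▸ hq)
  rw [← hg Z hZ] at hub
  have left : Coupled f g (0, 0) (p + q, Z) := by
    refine Coupled.congr_left (K := p + q) (fun k hk => ?_) (greedyWalk_coupled_hub hD hE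
      (fun _ => rfl) (fun i hi => hg i (by omega)) hX0 hY0 (fun i _ => (hX i).2)
      (fun i _ => (hY i).2) (fun x hx => hpm x (by omega)) (fun y hy => hqm y (by omega))
      (fun i hi => hpm _ (hXm i (by omega))) (fun i hi => hqm _ (hYn i (by omega))) hub) le_rfl
    rw [hf k (by omega), domPath, if_pos hk]
  -- Reversing the indices turns the part after `Z` into a walk from the origin; the hub conditions
  -- `le` and `ge` exchange roles.
  have right : Coupled (fun k => f (m + n - k)) (fun i => g (N - i)) (0, 0)
      ((m - p) + (n - q), N - Z) := by
    have hXZ := hXm Z hZ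
    have hYZ := hYn Z hZ
    refine Coupled.congr_left (K := (m - p) + (n - q)) (fun k hk => ?_) (greedyWalk_coupled_hub
      hD' hE' (fun _ => rfl) (X := fun i => m - X (N - i)) (Y := fun i => n - Y (N - i))
      (fun i hi => ?_) ?_ ?_ (fun i hi => ?_) (fun i hi => ?_) (fun x hx => ?_) (fun x hx => ?_)
      (fun i hi => ?_) (fun i hi => ?_) ?_) le_rfl
    · rw [hf _ (by omega), domPath_of_ge hp hq (by omega), show m + n - (m + n - k) = k by omega]
    · rw [hg _ (by omega), Nat.sub_sub_self (hXm _ (by omega)), Nat.sub_sub_self (hYn _ (by omega))]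
    · simp [hXN]
    · simp [hYN]
    · have := (hX (N - (i + 1))).2
      rw [show N - (i + 1) + 1 = N - i by omega] at this
      have := hXm (N - i) (by omega)
      omega
    · have := (hY (N - (i + 1))).2
      rw [show N - (i + 1) + 1 = N - i by omega] at this
      have := hYn (N - i) (by omega)
      omega
    · rw [Nat.sub_sub_self hp]
      exact hpm _ (by omega)
    · rw [Nat.sub_sub_self hq]
      exact hqm _ (by omega)
    · rw [Nat.sub_sub_self hp]
      exact hpm _ (by omega)
    · rw [Nat.sub_sub_self hq]
      exact hqm _ (by omega)
    · rw [Nat.sub_sub_self hZ]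
      have hge := hub.ge
      have hle := hub.le
      refine ⟨fun z hz => ?_, fun z hz => ?_, by omega, by omega⟩
      · rw [Nat.sub_sub_self hq]
        exact hub.row _ (by omega)
      · rw [Nat.sub_sub_self hp]
        exact hub.col _ (by omega)
  have right := right.reverse (fun _ => rfl) (fun _ => rfl)
  dsimp only at right
  rw [show m + n - (m - p + (n - q)) = p + q by omega, Nat.sub_sub_self hZ] at right
  exact left.trans right

end path

/-! ## Extensions and merges in terms of index maps -/

lemma isExtension_singleton (a : ℤ) : IsExtension [a] [a] :=
  ⟨[[a]], by simp, by simp⟩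

lemma IsExtension.snoc {e s : List ℤ} (h : IsExtension e s) (a : ℤ) :
    IsExtension (e ++ [a]) (s ++ [a]) := by
  obtain ⟨B, h1, rfl⟩ := h
  exact ⟨B ++ [[a]], List.rel_append h1 (by simp), by simp⟩

lemma IsExtension.repeat_last {e s : List ℤ} {a : ℤ} (h : IsExtension e (s ++ [a])) :
    IsExtension (e ++ [a]) (s ++ [a]) := by
  obtain ⟨B, h1, rfl⟩ := h
  rw [← List.forall₂_reverse_iff, List.reverse_append] at h1
  simp only [List.reverse_cons, List.reverse_nil, List.nil_append, List.singleton_append] at h1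
  obtain ⟨c, C, hc, hC, hB⟩ := List.forall₂_cons_right_iff.1 h1
  have hB' : B = C.reverse ++ [c] := by rw [← List.reverse_reverse B, hB]; simp
  subst hB'
  refine ⟨C.reverse ++ [c ++ [a]], List.rel_append ?_ ?_, by simp⟩
  · rw [← List.forall₂_reverse_iff]; simpa using hC
  · simp only [List.forall₂_cons, List.Forall₂.nil, and_true]
    refine ⟨by simp, fun x hx => ?_⟩
    rcases List.mem_append.1 hx with hx | hx
    · exact hc.2 x hx
    · simpa using hx

lemma isExtension_take_snoc {e s : List ℤ} {k k' : ℕ} (h : IsExtension e (s.take (k + 1)))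
    (hk : k' = k ∨ k' = k + 1) (hk' : k' < s.length) :
    IsExtension (e ++ [s.getD k' 0]) (s.take (k' + 1)) := by
  have hs : ∀ l < s.length, s.take (l + 1) = s.take l ++ [s.getD l 0] := by
    intro l hl
    rw [List.take_add_one, List.getElem?_eq_getElem hl, List.getD_eq_getElem _ _ hl]
    rfl
  rcases hk with rfl | rfl
  · rw [hs k' hk'] at h ⊢
    exact h.repeat_last
  · rw [hs _ hk']
    exact h.snoc _

lemma isExtension_take_one {s : List ℤ} (h : s ≠ []) : IsExtension [s.getD 0 0] (s.take 1) := by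
  cases s with
  | nil => exact absurd rfl h
  | cons a s => exact isExtension_singleton a

lemma isExtension_of_index {s : List ℤ} (hs : s ≠ []) {φ : ℕ → ℕ} (h0 : φ 0 = 0) {N : ℕ}
    (hN : φ N = s.length - 1) (h : ∀ i < N, φ (i + 1) = φ i ∨ φ (i + 1) = φ i + 1) :
    IsExtension ((List.range (N + 1)).map fun i => s.getD (φ i) 0) s := by
  have hpos := List.length_pos_iff.2 hs
  have hmono : ∀ i j, i + j ≤ N → φ i ≤ φ (i + j) := by
    intro i j
    induction j with
    | zero => simp
    | succ j ih =>
      intro hj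
      have := ih (by omega)
      have := h (i + j) (by omega)
      rw [← add_assoc]
      omega
  have key : ∀ n ≤ N, IsExtension ((List.range (n + 1)).map fun i => s.getD (φ i) 0)
      (s.take (φ n + 1)) := by
    intro n
    induction n with
    | zero => intro _; simpa [h0] using isExtension_take_one hs
    | succ n ih =>
      intro hn
      rw [List.range_succ, List.map_append]
      refine isExtension_take_snoc (ih (by omega)) (h n (by omega)) ?_
      have := hmono (n + 1) (N - (n + 1)) (by omega)
      rw [show n + 1 + (N - (n + 1)) = N by omega] at this
      omega
  have := key N le_rfl
  rwa [List.take_of_length_le (by omega)] at this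

/-- The index map sends a position to the number of its block. The step condition is asserted on all
of `ℕ`, also past the end of the list, so that the map is monotone without side conditions. -/
lemma IsExtension.exists_index {e s : List ℤ} (h : IsExtension e s) (hs : s ≠ []) :
    e ≠ [] ∧ ∃ φ : ℕ → ℕ, φ 0 = 0 ∧ φ (e.length - 1) = s.length - 1 ∧
      (∀ i, φ i ≤ φ (i + 1) ∧ φ (i + 1) ≤ φ i + 1) ∧ ∀ i < e.length, e.getD i 0 = s.getD (φ i) 0 := by
  obtain ⟨B, h1, rfl⟩ := h
  induction h1 with
  | nil => exact absurd rfl hs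
  | @cons b a B s hb hB ih =>
    obtain ⟨hb1, hb2⟩ := hb
    have hget : ∀ i < b.length, ∀ l : List ℤ, (b ++ l).getD i 0 = a := by
      intro i hi l
      rw [List.getD_append _ _ _ _ hi, List.getD_eq_getElem _ _ hi]
      exact hb2 _ (List.getElem_mem _)
    refine ⟨fun h => ?_, ?_⟩
    · rw [List.flatten_cons, List.append_eq_nil_iff] at h
      rw [h.1] at hb1
      simp at hb1
    rcases eq_or_ne s [] with rfl | hs'
    · cases hB
      refine ⟨fun _ => 0, rfl, by simp, by simp, fun i hi => ?_⟩
      simp only [List.flatten_cons, List.flatten_nil, List.append_nil] at hi ⊢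
      have := hget i hi []
      simpa using this
    · obtain ⟨hne, φ, h0, hl, hφ, hv⟩ := ih hs'
      have hpos := List.length_pos_iff.2 hs'
      have hpos' := List.length_pos_iff.2 hne
      refine ⟨fun i => if i < b.length then 0 else φ (i - b.length) + 1, if_pos hb1, ?_, ?_, ?_⟩
      · simp only [List.flatten_cons, List.length_append, List.length_cons]
        rw [if_neg (by omega), show b.length + B.flatten.length - 1 - b.length =
          B.flatten.length - 1 by omega, hl]
        omega
      · intro i
        dsimp only
        rcases lt_trichotomy (i + 1) b.length with hi | hi | hi
        · rw [if_pos hi, if_pos (by omega)]; omega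
        · rw [if_pos (show i < b.length by omega), if_neg (show ¬ i + 1 < b.length by omega), hi, Nat.sub_self, h0]; omega
        · rw [if_neg (show ¬ i < b.length by omega), if_neg (show ¬ i + 1 < b.length by omega), show i + 1 - b.length = i - b.length + 1 by omega]
          have := hφ (i - b.length)
          omega
      · intro i hi
        rw [List.flatten_cons] at hi ⊢
        rw [List.length_append] at hi
        dsimp only
        split_ifs with h
        · rw [hget i h]; simp
        · rw [List.getD_append_right _ _ _ _ (by omega), hv _ (by omega)]; simp

lemma mem_merges_of_index {r c : List ℤ} (hr : r ≠ []) (hc : c ≠ []) {X Y : ℕ → ℕ} {N : ℕ}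
    (hX0 : X 0 = 0) (hY0 : Y 0 = 0) (hXN : X N = r.length - 1) (hYN : Y N = c.length - 1)
    (hX : ∀ i < N, X (i + 1) = X i ∨ X (i + 1) = X i + 1)
    (hY : ∀ i < N, Y (i + 1) = Y i ∨ Y (i + 1) = Y i + 1) :
    (List.range (N + 1)).map (fun i => r.getD (X i) 0 + c.getD (Y i) 0) ∈ merges r c := by
  refine ⟨_, _, isExtension_of_index hr hX0 hXN hX, isExtension_of_index hc hY0 hYN hY, by simp, ?_⟩
  rw [List.zipWith_map, List.zipWith_self]

lemma exists_index_of_mem_merges {r c q : List ℤ} (hr : r ≠ []) (hc : c ≠ [])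
    (hq : q ∈ merges r c) : q ≠ [] ∧ ∃ X Y : ℕ → ℕ, X 0 = 0 ∧ Y 0 = 0 ∧
      X (q.length - 1) = r.length - 1 ∧ Y (q.length - 1) = c.length - 1 ∧
      (∀ i, X i ≤ X (i + 1) ∧ X (i + 1) ≤ X i + 1) ∧
      (∀ i, Y i ≤ Y (i + 1) ∧ Y (i + 1) ≤ Y i + 1) ∧
      ∀ i < q.length, q.getD i 0 = r.getD (X i) 0 + c.getD (Y i) 0 := by
  obtain ⟨r', c', h1, h2, hl, rfl⟩ := hq
  obtain ⟨n1, X, hX0, hXN, hX, hXv⟩ := h1.exists_index hr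
  obtain ⟨n2, Y, hY0, hYN, hY, hYv⟩ := h2.exists_index hc
  have hlen : (List.zipWith (· + ·) r' c').length = r'.length := by simp [hl]
  refine ⟨?_, X, Y, hX0, hY0, by rw [hlen, hXN], by rw [hlen, hl, hYN], hX, hY, fun i hi => ?_⟩
  · rw [← List.length_pos_iff, hlen]; exact List.length_pos_iff.2 n1
  · rw [hlen] at hi
    rw [← hXv i hi, ← hYv i (hl ▸ hi), List.getD_eq_getElem _ _ (hlen ▸ hi),
      List.getD_eq_getElem _ _ hi, List.getD_eq_getElem _ _ (hl ▸ hi), List.getElem_zipWith]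

/-- Recording both entries at each step of the coupling spells out the two extensions. The
hypothesis `h0` covers the starting pair, about which an empty coupling says nothing. -/
lemma Coupled.dominates {t q : List ℤ} (ht : t ≠ []) (hq : q ≠ [])
    (h0 : t.getD 0 0 ≤ q.getD 0 0)
    (h : Coupled (fun k => t.getD k 0) (fun k => q.getD k 0) (0, 0) (t.length - 1, q.length - 1)) :
    Dominates t q := by
  have ht' := List.length_pos_iff.2 ht
  have hq' := List.length_pos_iff.2 hq
  have key : ∀ v, Coupled (fun k => t.getD k 0) (fun k => q.getD k 0) (0, 0) v →
      v.1 < t.length → v.2 < q.length → ∃ t' q', IsExtension t' (t.take (v.1 + 1)) ∧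
        IsExtension q' (q.take (v.2 + 1)) ∧ List.Forall₂ (· ≤ ·) t' q' := by
    intro v hv
    induction hv with
    | refl =>
      intro _ _
      exact ⟨_, _, isExtension_take_one ht, isExtension_take_one hq, by simpa using h0⟩
    | tail _ h ih =>
      intro h1 h2
      obtain ⟨s1, s2, -, s3⟩ := h
      obtain ⟨t', q', e1, e2, e3⟩ := ih (by omega) (by omega)
      exact ⟨_, _, isExtension_take_snoc e1 s1 h1, isExtension_take_snoc e2 s2 h2,
        List.rel_append e3 (by simpa using s3)⟩
  obtain ⟨t', q', e1, e2, e3⟩ := key _ h (by dsimp only; omega) (by dsimp only; omega)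
  rw [List.take_of_length_le (by dsimp only; omega)] at e1 e2
  exact ⟨t', q', e1, e2, e3⟩

/-! ## The dominating merge -/

def domMerge (r c : List ℤ) (D E D' E' : ℕ → ℤ) (p q : ℕ) : List ℤ :=
  (List.range (r.length - 1 + (c.length - 1) + 1)).map fun k =>
    mergeEntry r c (domPath D E D' E' (r.length - 1) (c.length - 1) p q k)

section domMerge

variable {r c : List ℤ} {D E D' E' : ℕ → ℤ} {p q : ℕ}

lemma domPath_zero {m n : ℕ} (hp : p ≤ m) (hq : q ≤ n) : domPath D E D' E' m n p q 0 = (0, 0) := by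
  have := domPath_bounds (D := D) (E := E) (D' := D') (E' := E') hp hq (Nat.zero_le (m + n))
  ext <;> dsimp only <;> omega

lemma domPath_last {m n : ℕ} (hp : p ≤ m) (hq : q ≤ n) :
    domPath D E D' E' m n p q (m + n) = (m, n) := by
  have := domPath_bounds (D := D) (E := E) (D' := D') (E' := E') hp hq le_rfl
  ext <;> dsimp only <;> omega

lemma domMerge_mem_nonDiagMerges (hr : r ≠ []) (hc : c ≠ []) (hp : p ≤ r.length - 1)
    (hq : q ≤ c.length - 1) : domMerge r c D E D' E' p q ∈ nonDiagMerges r c := by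
  have hr' := List.length_pos_iff.2 hr
  have hc' := List.length_pos_iff.2 hc
  refine ⟨(List.range (r.length - 1 + (c.length - 1) + 1)).map
    (domPath D E D' E' (r.length - 1) (c.length - 1) p q), ⟨?_, ?_, ?_, ?_⟩, ?_⟩
  · intro x hx
    obtain ⟨k, hk, rfl⟩ := List.mem_map.1 hx
    have := domPath_bounds (D := D) (E := E) (D' := D') (E' := E') hp hq (k := k)
      (by have := List.mem_range.1 hk; omega)
    omega
  · simp [List.range_succ_eq_map, domPath_zero hp hq]
  · simp [List.range_succ, domPath_last hp hq]
  · rw [List.isChain_iff_getElem]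
    intro i hi
    simp only [List.length_map, List.length_range] at hi
    simp only [List.getElem_map, List.getElem_range]
    exact domPath_nonDiagStep hp hq (by omega)
  · simp [domMerge]

lemma domMerge_mem_merges (hr : r ≠ []) (hc : c ≠ []) (hp : p ≤ r.length - 1)
    (hq : q ≤ c.length - 1) : domMerge r c D E D' E' p q ∈ merges r c := by
  refine mem_merges_of_index hr hc
    (X := fun k => (domPath D E D' E' (r.length - 1) (c.length - 1) p q k).1)
    (Y := fun k => (domPath D E D' E' (r.length - 1) (c.length - 1) p q k).2)
    (N := r.length - 1 + (c.length - 1)) ?_ ?_ ?_ ?_ ?_ ?_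
  · rw [domPath_zero hp hq]
  · rw [domPath_zero hp hq]
  · rw [domPath_last hp hq]
  · rw [domPath_last hp hq]
  · intro i hi
    rcases domPath_nonDiagStep (D := D) (E := E) (D' := D') (E' := E') hp hq hi with h | h <;>
      rw [h] <;> simp
  · intro i hi
    rcases domPath_nonDiagStep (D := D) (E := E) (D' := D') (E' := E') hp hq hi with h | h <;>
      rw [h] <;> simp

lemma domMerge_dominates (hr : r ≠ []) (hc : c ≠ []) (hp : p ≤ r.length - 1)
    (hq : q ≤ c.length - 1) (hpm : ∀ x ≤ r.length - 1, r.getD p 0 ≤ r.getD x 0)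
    (hqm : ∀ y ≤ c.length - 1, c.getD q 0 ≤ c.getD y 0)
    (hD : IsClimb (fun x => r.getD x 0) p D) (hE : IsClimb (fun y => c.getD y 0) q E)
    (hD' : IsClimb (fun x => r.getD (r.length - 1 - x) 0) (r.length - 1 - p) D')
    (hE' : IsClimb (fun y => c.getD (c.length - 1 - y) 0) (c.length - 1 - q) E')
    {s : List ℤ} (hs : s ∈ merges r c) : Dominates (domMerge r c D E D' E' p q) s := by
  obtain ⟨hs', X, Y, hX0, hY0, hXN, hYN, hX, hY, hv⟩ := exists_index_of_mem_merges hr hc hs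
  have hlen : (domMerge r c D E D' E' p q).length = r.length - 1 + (c.length - 1) + 1 := by
    simp [domMerge]
  have hget : ∀ k ≤ r.length - 1 + (c.length - 1), (domMerge r c D E D' E' p q).getD k 0 =
      mergeEntry r c (domPath D E D' E' (r.length - 1) (c.length - 1) p q k) := by
    intro k hk
    rw [List.getD_eq_getElem _ _ (by omega)]
    simp [domMerge]
  have hpos := List.length_pos_iff.2 hs'
  refine Coupled.dominates (by rw [← List.length_pos_iff]; omega) hs' ?_ ?_
  · rw [hget 0 (by omega), hv 0 hpos, domPath_zero hp hq, hX0, hY0, mergeEntry]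
  · rw [hlen]
    exact domPath_coupled (a := fun x => r.getD x 0) (b := fun y => c.getD y 0) hp hq hpm hqm
      hD hE hD' hE' hX hY hX0 hY0 hXN hYN hget (fun i hi => hv i (by omega))

end domMerge

/-! ## Running time of programs -/

namespace RAM

/-- Started in `s`, the program `P` halts after at most `k` steps in a state that satisfies `Q`. -/
def Runs (P : Prog) (s : State) (k : ℕ) (Q : State → Prop) : Prop :=
  ∃ k' ≤ k, ∃ s', Exec P s k' s' ∧ Q s'

lemma Runs.mono {P : Prog} {s : State} {k l : ℕ} {Q R : State → Prop} (h : Runs P s k Q)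
    (hkl : k ≤ l) (hQR : ∀ s', Q s' → R s') : Runs P s l R := by
  obtain ⟨k', hk, s', h1, h2⟩ := h
  exact ⟨k', hk.trans hkl, s', h1, hQR s' h2⟩

lemma Runs.seq {P P' : Prog} {s : State} {k l : ℕ} {Q R : State → Prop} (h : Runs P s k Q)
    (h' : ∀ s', Q s' → Runs P' s' l R) : Runs (.seq P P') s (k + l) R := by
  obtain ⟨k', hk, s', h1, h2⟩ := h
  obtain ⟨l', hl, s'', h3, h4⟩ := h' s' h2
  exact ⟨k' + l', by omega, s'', .seq h1 h3, h4⟩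

lemma Runs.loop {e f : Expr} {P : Prog} {C N : ℕ} (Inv : ℕ → State → Prop)
    (hstep : ∀ n < N, ∀ s, Inv n s → e.eval s ≤ f.eval s ∧ Runs P s C (Inv (n + 1)))
    (hend : ∀ s, Inv N s → ¬ e.eval s ≤ f.eval s) {s : State} (h0 : Inv 0 s) :
    Runs (.loop e f P) s ((N + 1) * (e.cost + f.cost + 1 + C)) (Inv N) := by
  -- Here `d` counts the remaining rounds; the final failing test is charged as a full round.
  have key : ∀ d n s, n + d = N → Inv n s →
      Runs (.loop e f P) s ((d + 1) * (e.cost + f.cost + 1 + C)) (Inv N) := by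
    intro d
    induction d with
    | zero =>
      rintro n s rfl h
      exact ⟨e.cost + f.cost + 1, by omega, s, .loop_done (hend s h), h⟩
    | succ d ih =>
      intro n s hn h
      obtain ⟨hef, k, hk, s', h1, h2⟩ := hstep n (by omega) s h
      obtain ⟨l, hl, s'', h3, h4⟩ := ih (n + 1) s' (by omega) h2
      refine ⟨_, ?_, s'', .loop_step hef h1 h3, h4⟩
      rw [Nat.succ_mul]
      omega
  exact key N 0 s (by omega) h0

/-- The weakest precondition of a loop-free program. -/
def Prog.wp : Prog → (State → Prop) → State → Prop
  | .skip, Q, s => Q s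
  | .assign x e, Q, s => Q (s.setVar x (e.eval s))
  | .store a i e, Q, s => Q (s.setArr a (i.eval s) (e.eval s))
  | .seq P P', Q, s => P.wp (fun s' => P'.wp Q s') s
  | .ite e f P P', Q, s =>
    (e.eval s ≤ f.eval s → P.wp Q s) ∧ (¬ e.eval s ≤ f.eval s → P'.wp Q s)
  | .loop _ _ _, _, _ => False

/-- An upper bound on the number of steps of a loop-free program. -/
def Prog.bound : Prog → ℕ
  | .skip => 1
  | .assign _ e => e.cost + 1
  | .store _ i e => i.cost + e.cost + 1
  | .seq P P' => P.bound + P'.bound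
  | .ite e f P P' => e.cost + f.cost + 1 + (P.bound + P'.bound)
  | .loop _ _ _ => 0

lemma Prog.runs_of_wp {P : Prog} {s : State} {Q : State → Prop} (h : P.wp Q s) :
    Runs P s P.bound Q := by
  induction P generalizing s Q with
  | skip => exact ⟨1, le_rfl, s, .skip s, h⟩
  | assign x e => exact ⟨_, le_rfl, _, .assign s x e, h⟩
  | store a i e => exact ⟨_, le_rfl, _, .store s a i e, h⟩
  | seq P P' ihP ihP' => exact (ihP h).seq fun s' hs' => ihP' hs'
  | ite e f P P' ihP ihP' =>
    by_cases hc : e.eval s ≤ f.eval s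
    · obtain ⟨k, hk, s', h1, h2⟩ := ihP (h.1 hc)
      refine ⟨_, ?_, s', .ite_true hc h1, h2⟩
      simp only [Prog.bound]; omega
    · obtain ⟨k, hk, s', h1, h2⟩ := ihP' (h.2 hc)
      refine ⟨_, ?_, s', .ite_false hc h1, h2⟩
      simp only [Prog.bound]; omega
  | loop => exact h.elim

@[simp] lemma State.setVar_var (s : State) (x : ℕ) (v : ℤ) (y : ℕ) :
    (s.setVar x v).var y = if y = x then v else s.var y := by
  simp [State.setVar, Function.update_apply]

@[simp] lemma State.setVar_arr (s : State) (x : ℕ) (v : ℤ) : (s.setVar x v).arr = s.arr := rfl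

@[simp] lemma State.setArr_var (s : State) (a : ℕ) (i v : ℤ) : (s.setArr a i v).var = s.var := rfl

@[simp] lemma State.setArr_arr (s : State) (a : ℕ) (i v : ℤ) (b : ℕ) :
    (s.setArr a i v).arr b = if b = a then Function.update (s.arr a) i v else s.arr b := by
  simp [State.setArr, Function.update_apply]

/-! ## Scanning for climbs -/

/-- The state still holds the input `r`, `c`. -/
structure HasInput (r c : List ℤ) (s : State) : Prop where
  var0 : s.var 0 = r.length
  var1 : s.var 1 = c.length
  arr0 : ∀ i : ℕ, s.arr 0 i = r.getD i 0
  arr1 : ∀ i : ℕ, s.arr 1 i = c.getD i 0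

lemma HasInput.of_eq {r c : List ℤ} {s s' : State} (h : HasInput r c s)
    (h0 : s'.var 0 = s.var 0) (h1 : s'.var 1 = s.var 1) (h2 : s'.arr 0 = s.arr 0)
    (h3 : s'.arr 1 = s.arr 1) : HasInput r c s' :=
  ⟨h0 ▸ h.var0, h1 ▸ h.var1, h2 ▸ h.arr0, h3 ▸ h.arr1⟩

@[simp] lemma hasInput_setVar {r c : List ℤ} {s : State} {x : ℕ} {v : ℤ} (h : HasInput r c s)
    (hx : 2 ≤ x) : HasInput r c (s.setVar x v) :=
  h.of_eq (by simp; omega) (by simp; omega) rfl rfl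

/-- The expression `A x` reads the entry of the sequence `a` at the index held by `x`. -/
structure Reads (r c : List ℤ) (A : ℕ → Expr) (a : ℕ → ℤ) (m : ℕ) : Prop where
  eval : ∀ s, HasInput r c s → ∀ x i : ℕ, i < m → s.var x = i → (A x).eval s = a i
  cost : ∀ x, (A x).cost ≤ 6

/-- Variable `3` is the current index, `4` the last prefix minimum, `5` the maximum since then. The
climb at the last prefix minimum is rewritten in every round that finds no new one, so it is final
once the next is found. -/
def scanBody (A : ℕ → Expr) (d : ℕ) : Prog :=
  .seq (.assign 3 (.add (.var 3) (.const 1)))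
    (.ite (A 3) (A 4)
      (.seq (.assign 4 (.var 3)) (.seq (.assign 5 (A 3)) (.store d (.var 3) (.const 0))))
      (.seq (.ite (.var 5) (A 3) (.assign 5 (A 3)) .skip)
        (.seq (.store d (.var 4) (.sub (.var 5) (A 4))) (.store d (.var 3) (.const (-1))))))

def scanInit (A : ℕ → Expr) (d : ℕ) : Prog :=
  .seq (.assign 3 (.const 0)) (.seq (.assign 4 (.const 0))
    (.seq (.assign 5 (A 4)) (.store d (.var 4) (.const 0))))

/-- Store the climbs of a sequence in the array `d`, and its last minimum in the variable `4`. -/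
def scan (A : ℕ → Expr) (len d : ℕ) : Prog :=
  .seq (scanInit A d) (.loop (.add (.var 3) (.const 2)) (.var len) (scanBody A d))

/-- The state of a scan up to index `X`: the last prefix minimum is `l`, and `g` is the maximum
from there on. -/
structure Scanned (a : ℕ → ℤ) (X l : ℕ) (g : ℤ) (D : ℕ → ℤ) : Prop where
  le : l ≤ X
  isPrefixMin : IsPrefixMin a l
  above : ∀ y, l < y → y ≤ X → a l < a y ∧ D y = -1
  climb_eq : D l = g - a l
  ub : ∀ y, l ≤ y → y ≤ X → a y ≤ g
  attained : ∃ z, l ≤ z ∧ z ≤ X ∧ a z = g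
  isClimb : IsClimb a l D

lemma scanned_zero {a D : ℕ → ℤ} (h : D 0 = 0) : Scanned a 0 0 (a 0) D where
  le := le_rfl
  isPrefixMin x hx := by rw [Nat.le_zero.1 hx]
  above y h1 h2 := by omega
  climb_eq := by omega
  ub y _ hy := by rw [Nat.le_zero.1 hy]
  attained := ⟨0, le_rfl, le_rfl, rfl⟩
  isClimb i hi := by omega

lemma IsClimb.congr {a : ℕ → ℤ} {p : ℕ} {D D' : ℕ → ℤ} (h : IsClimb a p D)
    (hD : ∀ i < p, D' i = D i) : IsClimb a p D' := by
  intro i hi hr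
  obtain ⟨i', h1, h2, h3, h4, h5⟩ := h i hi hr
  rw [hD i hi]
  exact ⟨i', h1, h2, h3, fun x hx hx' => by rw [hD x (by omega)]; exact h4 x hx hx', h5⟩

lemma Scanned.succ_of_le {a D D' : ℕ → ℤ} {X l : ℕ} {g : ℤ} (h : Scanned a X l g D)
    (ha : a (X + 1) ≤ a l) (hD : D' (X + 1) = 0) (hD' : ∀ i ≤ X, D' i = D i) :
    Scanned a (X + 1) (X + 1) (a (X + 1)) D' := by
  have hmin : IsPrefixMin a (X + 1) := by
    intro x hx
    rcases hx.eq_or_lt with rfl | hx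
    · exact le_rfl
    rcases le_or_gt x l with h' | h'
    · exact ha.trans (h.isPrefixMin x h')
    · exact ha.trans (h.above x h' (by omega)).1.le
  have hl := h.le
  refine ⟨le_rfl, hmin, fun y h1 h2 => by omega, by omega, fun y h1 h2 => ?_,
    ⟨X + 1, le_rfl, le_rfl, rfl⟩, fun i hi hr => ?_⟩
  · rw [le_antisymm h2 h1]
  rcases lt_trichotomy i l with hil | rfl | hil
  · obtain ⟨i', h1, h2, h3, h4, h5⟩ := h.isClimb i hil hr
    rw [hD' i (by omega)]
    exact ⟨i', h1, by omega, h3,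
      fun x hx hx' => by rw [hD' x (by omega)]; exact h4 x hx hx', h5⟩
  -- The new prefix minimum `X + 1` closes the climb of the previous one, whose running maximum
  -- becomes its peak.
  · have hDl := h.climb_eq
    rw [hD' i h.le]
    obtain ⟨z, hz, hz', haz⟩ := h.attained
    refine ⟨X + 1, hi, le_rfl, hmin, fun x hx hx' => ?_, fun x hx hx' => ?_,
      ⟨z, hz, by omega, by omega⟩⟩
    · rw [hD' x (by omega)]
      exact h.above x hx (by omega)
    · rcases hx'.eq_or_lt with rfl | hx'
      · have := h.ub i le_rfl h.le
        omega
      · have := h.ub x hx (by omega)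
        omega
  · have := hr l hil.le
    have := (h.above i hil (by omega)).1
    omega

lemma Scanned.succ_of_lt {a D D' : ℕ → ℤ} {X l : ℕ} {g g' : ℤ} (h : Scanned a X l g D)
    (ha : a l < a (X + 1)) (hg : g' = max g (a (X + 1))) (hD : D' (X + 1) = -1)
    (hDl : D' l = g' - a l) (hD' : ∀ i ≤ X, i ≠ l → D' i = D i) :
    Scanned a (X + 1) l g' D' := by
  have hl := h.le
  refine ⟨by omega, h.isPrefixMin, fun y hy hy' => ?_, hDl, fun y hy hy' => ?_, ?_,
    IsClimb.congr h.isClimb fun i hi => hD' i (by omega) (by omega)⟩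
  · rcases hy'.eq_or_lt with rfl | hy'
    · exact ⟨ha, hD⟩
    · rw [hD' y (by omega) (by omega)]
      exact h.above y hy (by omega)
  · rcases hy'.eq_or_lt with rfl | hy'
    · omega
    · have := h.ub y hy (by omega)
      omega
  · rcases le_total g (a (X + 1)) with hc | hc
    · exact ⟨X + 1, by omega, le_rfl, by omega⟩
    · obtain ⟨z, h1, h2, h3⟩ := h.attained
      exact ⟨z, h1, by omega, by omega⟩

lemma scan_runs {r c : List ℤ} {A : ℕ → Expr} {a : ℕ → ℤ} {m len d : ℕ}
    (hA : Reads r c A a m) (hm : 0 < m) (hd : 2 ≤ d) {s : State} (hs : HasInput r c s)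
    (hlen : s.var len = m) (hlen' : len < 2) :
    Runs (scan A len d) s (200 * m) fun s' =>
      (∀ x, x ≠ 3 → x ≠ 4 → x ≠ 5 → s'.var x = s.var x) ∧ (∀ b, b ≠ d → s'.arr b = s.arr b) ∧
      ∃ (l : ℕ) (g : ℤ), s'.var 4 = l ∧ Scanned a (m - 1) l g fun i => s'.arr d i := by
  set Inv : ℕ → State → Prop := fun X s' =>
    (∀ x, x ≠ 3 → x ≠ 4 → x ≠ 5 → s'.var x = s.var x) ∧ (∀ b, b ≠ d → s'.arr b = s.arr b) ∧
      s'.var 3 = X ∧ ∃ l : ℕ, s'.var 4 = l ∧ Scanned a X l (s'.var 5) fun i => s'.arr d i with hInv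
  have c3 := hA.cost 3
  have c4 := hA.cost 4
  have init : Runs (scanInit A d) s 20 (Inv 0) := by
    refine (Prog.runs_of_wp (Q := Inv 0) ?_).mono ?_ fun _ h => h
    · have hread : (A 4).eval ((s.setVar 3 0).setVar 4 0) = a 0 :=
        hA.eval _ (by simp [hs]) 4 0 hm (by simp)
      simp only [scanInit, Prog.wp, Expr.eval, hread]
      refine ⟨fun x h3 h4 h5 => by simp [h3, h4, h5], fun b hb => by simp [hb], by simp, 0,
        by simp, ?_⟩
      simp
      exact scanned_zero (by simp)
    · simp only [scanInit, Prog.bound, Expr.cost]; omega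
  -- The test says that index `X + 1` still exists, so there are exactly `m - 1` rounds.
  have loop := fun s' (h : Inv 0 s') => Runs.loop (e := .add (.var 3) (.const 2)) (f := .var len)
    (P := scanBody A d) (C := 80) (N := m - 1) Inv
    (fun X hX s' h => by
      obtain ⟨hv, ha, h3, l, h4, hsc⟩ := h
      have hin : HasInput r c s' := hs.of_eq (hv 0 (by simp) (by simp) (by simp))
        (hv 1 (by simp) (by simp) (by simp)) (ha 0 (by omega)) (ha 1 (by omega))
      have hl := hsc.le
      refine ⟨?_, (Prog.runs_of_wp (Q := Inv (X + 1)) ?_).mono ?_ fun _ h => h⟩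
      · simp only [Expr.eval, h3, hv len (by omega) (by omega) (by omega), hlen]
        omega
      · set s1 := s'.setVar 3 (s'.var 3 + 1) with hs1
        have hin1 : HasInput r c s1 := hasInput_setVar hin (by omega)
        have e3 : (A 3).eval s1 = a (X + 1) :=
          hA.eval _ hin1 3 (X + 1) (by omega) (by simp [hs1, h3])
        have e4 : (A 4).eval s1 = a l := hA.eval _ hin1 4 l (by omega) (by simp [hs1, h4])
        have e3' : ∀ v, (A 3).eval (s1.setVar 4 v) = a (X + 1) := fun v =>
          hA.eval _ (hasInput_setVar hin1 (by omega)) 3 (X + 1) (by omega) (by simp [hs1, h3])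
        have e4' : ∀ v, (A 4).eval (s1.setVar 5 v) = a l := fun v =>
          hA.eval _ (hasInput_setVar hin1 (by omega)) 4 l (by omega) (by simp [hs1, h4])
        simp only [scanBody, Prog.wp, Expr.eval]
        rw [← hs1, e3, e4]
        refine ⟨fun hc => ?_, fun hc => ⟨fun hg => ?_, fun hg => ?_⟩⟩
        · rw [e3']
          refine ⟨fun x n3 n4 n5 => by simp [hs1, n3, n4, n5, hv],
            fun b hb => by simp [hs1, hb, ha], by simp [hs1, h3], X + 1, by simp [hs1, h3], ?_⟩
          simp only [hs1, State.setArr_var, State.setArr_arr, State.setVar_var, State.setVar_arr,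
            h3, if_true]
          norm_num
          exact hsc.succ_of_le hc (by simp) fun i hi =>
            Function.update_of_ne (by omega) _ _
        · rw [e4']
          refine ⟨fun x n3 n4 n5 => by simp [hs1, n3, n4, n5, hv],
            fun b hb => by simp [hs1, hb, ha], by simp [hs1, h3], l, by simp [hs1, h4], ?_⟩
          have hg' : s'.var 5 ≤ a (X + 1) := by simpa [hs1] using hg
          simp only [hs1, State.setArr_var, State.setArr_arr, State.setVar_var, State.setVar_arr,
            h3, h4, if_true]
          norm_num
          refine hsc.succ_of_lt (by omega) (max_eq_right hg').symm (by simp) ?_ fun i hi hil => ?_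
          · rw [Function.update_of_ne (by omega), Function.update_self]
          · rw [Function.update_of_ne (by omega), Function.update_of_ne (by omega)]
        · refine ⟨fun x n3 n4 n5 => by simp [hs1, n3, n4, n5, hv],
            fun b hb => by simp [hs1, hb, ha], by simp [hs1, h3], l, by simp [hs1, h4], ?_⟩
          have hg' : ¬ s'.var 5 ≤ a (X + 1) := by simpa [hs1] using hg
          simp only [hs1, State.setArr_var, State.setArr_arr, State.setVar_var, State.setVar_arr,
            h3, h4, if_true]
          norm_num
          refine hsc.succ_of_lt (by omega) (max_eq_left (by omega)).symm (by simp) ?_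
            fun i hi hil => ?_
          · rw [Function.update_of_ne (by omega), Function.update_self]
          · rw [Function.update_of_ne (by omega), Function.update_of_ne (by omega)]
      · simp only [scanBody, Prog.bound, Expr.cost]; omega)
    (fun s' h => by
      obtain ⟨hv, -, h3, -⟩ := h
      simp only [Expr.eval, h3, hv len (by omega) (by omega) (by omega), hlen]
      omega)
    h
  refine (init.seq loop).mono ?_ fun s' h => ?_
  · simp only [Expr.cost]
    omega
  · obtain ⟨hv, ha, -, l, h4, hsc⟩ := h
    exact ⟨hv, ha, l, _, h4, hsc⟩

/-! ## Walking greedily -/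

/-- Variables `6`, `7` are the target and `8`, `9` the position. The first two tests handle a
coordinate that has arrived, so climbs are compared only while both coordinates still have to move.
-/
def walkBody (A B : ℕ → Expr) (W : Expr) : Prog :=
  .seq
    (.ite (.var 6) (.var 8) (.assign 9 (.add (.var 9) (.const 1)))
      (.ite (.var 7) (.var 9) (.assign 8 (.add (.var 8) (.const 1)))
        (.ite (.get 3 (.var 8)) (.get 4 (.var 9)) (.assign 8 (.add (.var 8) (.const 1)))
          (.assign 9 (.add (.var 9) (.const 1))))))
    (.store 2 W (.add (A 8) (B 9)))

def walkInit (A B : ℕ → Expr) (W : Expr) : Prog :=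
  .seq (.assign 8 (.const 0)) (.seq (.assign 9 (.const 0)) (.store 2 W (.add (A 8) (B 9))))

/-- Follow the greedy walk to the indices held by the variables `6` and `7`, for the climbs in the
arrays `3` and `4`, and store the entries along the walk in the array `2` at the indices `W`. -/
def walk (A B : ℕ → Expr) (W : Expr) : Prog :=
  .seq (walkInit A B W)
    (.loop (.add (.add (.var 8) (.var 9)) (.const 1)) (.add (.var 6) (.var 7)) (walkBody A B W))

lemma walk_runs {r c : List ℤ} {A B : ℕ → Expr} {W : Expr} {a b : ℕ → ℤ} {m n p q : ℕ}
    {w : ℕ → ℤ} (hA : Reads r c A a m) (hB : Reads r c B b n) (hp : p < m) (hq : q < n)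
    (hW : ∀ s, HasInput r c s → ∀ i j : ℕ, s.var 8 = i → s.var 9 = j → W.eval s = w (i + j))
    (hWc : W.cost ≤ 20) (hw : Function.Injective w)
    {s : State} (hs : HasInput r c s) (h6 : s.var 6 = p) (h7 : s.var 7 = q) :
    Runs (walk A B W) s (200 * (p + q + 1)) fun s' =>
      (∀ x, x ≠ 8 → x ≠ 9 → s'.var x = s.var x) ∧ (∀ b, b ≠ 2 → s'.arr b = s.arr b) ∧
      (∀ z, (∀ k ≤ p + q, z ≠ w k) → s'.arr 2 z = s.arr 2 z) ∧
      ∀ k ≤ p + q, s'.arr 2 (w k) =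
        a (greedyWalk (fun i => s.arr 3 i) (fun j => s.arr 4 j) p q k).1 +
          b (greedyWalk (fun i => s.arr 3 i) (fun j => s.arr 4 j) p q k).2 := by
  set G := greedyWalk (fun i => s.arr 3 i) (fun j => s.arr 4 j) p q with hG
  set Inv : ℕ → State → Prop := fun K s' =>
    (∀ x, x ≠ 8 → x ≠ 9 → s'.var x = s.var x) ∧ (∀ b, b ≠ 2 → s'.arr b = s.arr b) ∧
      s'.var 8 = (G K).1 ∧ s'.var 9 = (G K).2 ∧
      (∀ z, (∀ k ≤ K, z ≠ w k) → s'.arr 2 z = s.arr 2 z) ∧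
      ∀ k ≤ K, s'.arr 2 (w k) = a (G k).1 + b (G k).2 with hInv
  have c8 := hA.cost 8
  have c9 := hB.cost 9
  have hin : ∀ s', (∀ x, x ≠ 8 → x ≠ 9 → s'.var x = s.var x) →
      (∀ b, b ≠ 2 → s'.arr b = s.arr b) → HasInput r c s' := fun s' hv ha =>
    hs.of_eq (hv 0 (by simp) (by simp)) (hv 1 (by simp) (by simp)) (ha 0 (by simp))
      (ha 1 (by simp))
  -- Injectivity of `w` ensures that writing the entry at time `K` leaves the earlier ones intact.
  have store : ∀ s' : State, (∀ x, x ≠ 8 → x ≠ 9 → s'.var x = s.var x) →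
      (∀ b, b ≠ 2 → s'.arr b = s.arr b) → ∀ K ≤ p + q, s'.var 8 = (G K).1 → s'.var 9 = (G K).2 →
      (∀ z, (∀ k < K, z ≠ w k) → s'.arr 2 z = s.arr 2 z) →
      (∀ k < K, s'.arr 2 (w k) = a (G k).1 + b (G k).2) →
      Inv K (s'.setArr 2 (W.eval s') ((A 8).eval s' + (B 9).eval s')) := by
    intro s' hv ha K hK h8 h9 hz hk
    obtain ⟨g1, g2, g3⟩ := greedyWalk_bounds (D := fun i => s.arr 3 i) (E := fun j => s.arr 4 j) hK
    rw [← hG] at g1 g2 g3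
    have hin' := hin s' hv ha
    rw [hW s' hin' _ _ h8 h9, g3, hA.eval s' hin' 8 _ (by omega) h8,
      hB.eval s' hin' 9 _ (by omega) h9]
    refine ⟨hv, fun b hb => by simp [hb, ha], h8, h9, fun z h => ?_, fun k hk' => ?_⟩
    · simp only [State.setArr_arr, if_true]
      rw [Function.update_of_ne (h K le_rfl)]
      exact hz z fun k hk => h k hk.le
    · simp only [State.setArr_arr, if_true]
      rcases hk'.eq_or_lt with rfl | hk'
      · rw [Function.update_self]
      · rw [Function.update_of_ne (hw.ne hk'.ne)]
        exact hk k hk'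
  have init : Runs (walkInit A B W) s 50 (Inv 0) := by
    refine (Prog.runs_of_wp (Q := Inv 0) ?_).mono ?_ fun _ h => h
    · simp only [walkInit, Prog.wp, Expr.eval]
      refine store ((s.setVar 8 0).setVar 9 0) (fun x h8 h9 => by simp [h8, h9])
        (fun b hb => rfl) 0 (by omega) ?_ ?_
        (fun z _ => rfl) (fun k hk => by omega)
      · simp [hG, greedyWalk]
      · simp [hG, greedyWalk]
    · simp only [walkInit, Prog.bound, Expr.cost]; omega
  have loop := fun s' (h : Inv 0 s') => Runs.loop
    (e := .add (.add (.var 8) (.var 9)) (.const 1)) (f := .add (.var 6) (.var 7))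
    (P := walkBody A B W) (C := 70) (N := p + q) Inv
    (fun K hK s' h => by
      obtain ⟨hv, ha, h8, h9, hz, hk⟩ := h
      have h6' := (hv 6 (by simp) (by simp)).trans h6
      have h7' := (hv 7 (by simp) (by simp)).trans h7
      obtain ⟨g1, g2, g3⟩ := greedyWalk_bounds (D := fun i => s.arr 3 i)
        (E := fun j => s.arr 4 j) hK.le
      rw [← hG] at g1 g2 g3
      refine ⟨?_, (Prog.runs_of_wp (Q := Inv (K + 1)) ?_).mono ?_ fun _ h => h⟩
      · simp only [Expr.eval, h8, h9, h6', h7']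
        omega
      · have hsucc : G (K + 1) = _ := greedyWalk_succ K
        rw [← hG, walkStep] at hsucc
        have inc8 : (G K).1 < p ∧ (q ≤ (G K).2 ∨ s.arr 3 (G K).1 ≤ s.arr 4 (G K).2) →
            Inv (K + 1) ((s'.setVar 8 (s'.var 8 + 1)).setArr 2
              (W.eval (s'.setVar 8 (s'.var 8 + 1))) ((A 8).eval (s'.setVar 8 (s'.var 8 + 1)) +
                (B 9).eval (s'.setVar 8 (s'.var 8 + 1)))) := by
          intro hc
          rw [if_pos hc] at hsucc
          exact store (s'.setVar 8 (s'.var 8 + 1)) (fun x n8 n9 => by simp [n8, hv x n8 n9]) ha (K + 1) (by omega)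
            (by simp [hsucc, h8]) (by simp [hsucc, h9])
            (fun z h => hz z fun k hk => h k (by omega)) fun k h => hk k (by omega)
        have inc9 : ¬ ((G K).1 < p ∧ (q ≤ (G K).2 ∨ s.arr 3 (G K).1 ≤ s.arr 4 (G K).2)) →
            Inv (K + 1) ((s'.setVar 9 (s'.var 9 + 1)).setArr 2
              (W.eval (s'.setVar 9 (s'.var 9 + 1))) ((A 8).eval (s'.setVar 9 (s'.var 9 + 1)) +
                (B 9).eval (s'.setVar 9 (s'.var 9 + 1)))) := by
          intro hc
          rw [if_neg hc] at hsucc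
          exact store (s'.setVar 9 (s'.var 9 + 1)) (fun x n8 n9 => by simp [n9, hv x n8 n9]) ha (K + 1) (by omega)
            (by simp [hsucc, h8]) (by simp [hsucc, h9])
            (fun z h => hz z fun k hk => h k (by omega)) fun k h => hk k (by omega)
        simp only [walkBody, Prog.wp, Expr.eval]
        rw [ha 3 (by simp), ha 4 (by simp), h6', h7']
        refine ⟨fun b1 => inc9 (by omega), fun b1 => ⟨fun b2 => inc8 (by omega),
          fun b2 => ⟨fun b3 => ?_, fun b3 => ?_⟩⟩⟩
        · rw [h8, h9] at b3
          exact inc8 ⟨by omega, Or.inr b3⟩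
        · rw [h8, h9] at b3
          exact inc9 (by omega)
      · simp only [walkBody, Prog.bound, Expr.cost]; omega)
    (fun s' h => by
      obtain ⟨hv, -, h8, h9, -⟩ := h
      have h6' := (hv 6 (by simp) (by simp)).trans h6
      have h7' := (hv 7 (by simp) (by simp)).trans h7
      obtain ⟨g1, g2, g3⟩ := greedyWalk_bounds (D := fun i => s.arr 3 i)
        (E := fun j => s.arr 4 j) (le_refl (p + q))
      rw [← hG] at g1 g2 g3
      simp only [Expr.eval, h8, h9, h6', h7']
      omega)
    h
  refine (init.seq loop).mono ?_ fun s' h => ?_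
  · simp only [Expr.cost]
    omega
  · obtain ⟨hv, ha, -, -, hz, hk⟩ := h
    exact ⟨hv, ha, hz, hk⟩

end RAM

namespace RAM

/-! ## The program -/

/-- Read the array `a` at the index held by a variable. -/
def fwd (a : ℕ) (x : ℕ) : Expr := .get a (.var x)

/-- Read the array `a`, whose length is held by the variable `a`, from its end. -/
def bwd (a : ℕ) (x : ℕ) : Expr := .get a (.sub (.sub (.var a) (.const 1)) (.var x))

/-- Determine the last minima of both sequences, and walk to them from the first index. -/
def forward : Prog :=
  .seq (scan (fwd 0) 0 3) (.seq (.assign 6 (.var 4)) (.seq (scan (fwd 1) 1 4)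
    (.seq (.assign 7 (.var 4)) (walk (fwd 0) (fwd 1) (.add (.var 8) (.var 9))))))

/-- Walk to the minima from the last index. -/
def backward : Prog :=
  .seq (scan (bwd 0) 0 3) (.seq (scan (bwd 1) 1 4)
    (.seq (.seq (.assign 6 (.sub (.sub (.var 0) (.const 1)) (.var 6)))
        (.assign 7 (.sub (.sub (.var 1) (.const 1)) (.var 7))))
      (.seq
        (walk (bwd 0) (bwd 1)
          (.sub (.sub (.add (.var 0) (.var 1)) (.const 2)) (.add (.var 8) (.var 9))))
        (.assign 2 (.sub (.add (.var 0) (.var 1)) (.const 1))))))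

/-! ### Correctness and linear running time of the program -/

variable {r c : List ℤ}

lemma reads_fwd_zero : Reads r c (fwd 0) (fun i => r.getD i 0) r.length where
  eval s hs x i hi hx := by simp only [fwd, Expr.eval, hx, hs.arr0]
  cost x := by simp [fwd, Expr.cost]

lemma reads_fwd_one : Reads r c (fwd 1) (fun i => c.getD i 0) c.length where
  eval s hs x i hi hx := by simp only [fwd, Expr.eval, hx, hs.arr1]
  cost x := by simp [fwd, Expr.cost]

lemma reads_bwd_zero : Reads r c (bwd 0) (fun i => r.getD (r.length - 1 - i) 0) r.length where
  eval s hs x i hi hx := by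
    simp only [bwd, Expr.eval, hx, hs.var0]
    rw [show (r.length : ℤ) - 1 - i = ((r.length - 1 - i : ℕ) : ℤ) by omega, hs.arr0]
  cost x := by simp [bwd, Expr.cost]

lemma reads_bwd_one : Reads r c (bwd 1) (fun i => c.getD (c.length - 1 - i) 0) c.length where
  eval s hs x i hi hx := by
    simp only [bwd, Expr.eval, hx, hs.var1]
    rw [show (c.length : ℤ) - 1 - i = ((c.length - 1 - i : ℕ) : ℤ) by omega, hs.arr1]
  cost x := by simp [bwd, Expr.cost]

lemma hasInput_input : HasInput r c (input r c) where
  var0 := by simp [input]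
  var1 := by simp [input]
  arr0 i := by simp [input]
  arr1 i := by simp [input]

lemma Scanned.min {a D : ℕ → ℤ} {X l : ℕ} {g : ℤ} (h : Scanned a X l g D) :
    ∀ x ≤ X, a l ≤ a x := by
  intro x hx
  rcases le_or_gt x l with h' | h'
  · exact h.isPrefixMin x h'
  · exact (h.above x h' hx).1.le

/-- The backward scan stops at its own last minimum, which in the original order is the first one,
while the target stays the minimum found by the forward scan. The climbs computed up to the former
also serve for any other minimum, since none lies beyond `l`. -/
lemma Scanned.isClimb_of_min {a D : ℕ → ℤ} {X l p : ℕ} {g : ℤ} (h : Scanned a X l g D)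
    (hp : p ≤ X) (hmin : ∀ x ≤ X, a p ≤ a x) : IsClimb a p D := by
  refine h.isClimb.mono ?_ fun x hx => hmin x (hx.trans hp)
  by_contra! hc
  have := (h.above p hc hp).1
  have := hmin l h.le
  omega

/-- The state after the forward half of the program. -/
structure Halfway (r c : List ℤ) (p q : ℕ) (D E : ℕ → ℤ) (s : State) : Prop where
  hasInput : HasInput r c s
  hp : p ≤ r.length - 1
  hq : q ≤ c.length - 1
  hpmin : ∀ x ≤ r.length - 1, r.getD p 0 ≤ r.getD x 0
  hqmin : ∀ y ≤ c.length - 1, c.getD q 0 ≤ c.getD y 0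
  hD : IsClimb (fun x => r.getD x 0) p D
  hE : IsClimb (fun y => c.getD y 0) q E
  var6 : s.var 6 = p
  var7 : s.var 7 = q
  out : ∀ k ≤ p + q, s.arr 2 (k : ℕ) = mergeEntry r c (greedyWalk D E p q k)

lemma forward_runs (hr : r ≠ []) (hc : c ≠ []) :
    Runs forward (input r c) (500 * (r.length + c.length)) fun s =>
      ∃ p q D E, Halfway r c p q D E s := by
  have hr' := List.length_pos_iff.2 hr
  have hc' := List.length_pos_iff.2 hc
  have hin : HasInput r c (input r c) := hasInput_input
  refine Runs.mono (k := 200 * r.length + (2 + (200 * c.length + (2 +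
    200 * (r.length + c.length))))) ?_ (by omega) fun _ h => h
  refine (scan_runs reads_fwd_zero hr' (by omega) hin hin.var0 (by omega)).seq ?_
  rintro s1 ⟨v1, a1, p, g, h1, sc1⟩
  have hin1 : HasInput r c s1 := hin.of_eq (v1 0 (by simp) (by simp) (by simp))
    (v1 1 (by simp) (by simp) (by simp)) (a1 0 (by simp)) (a1 1 (by simp))
  refine (Prog.runs_of_wp (P := .assign 6 (.var 4))
    (Q := fun s => s = s1.setVar 6 (s1.var 4)) rfl).seq ?_
  rintro s2 rfl
  have hin2 : HasInput r c (s1.setVar 6 (s1.var 4)) := hasInput_setVar hin1 (by omega)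
  refine (scan_runs reads_fwd_one hc' (by omega) hin2 hin2.var1 (by omega)).seq ?_
  rintro s3 ⟨v3, a3, q, g', h3, sc3⟩
  have hin3 : HasInput r c s3 := hin2.of_eq (v3 0 (by simp) (by simp) (by simp))
    (v3 1 (by simp) (by simp) (by simp)) (a3 0 (by simp)) (a3 1 (by simp))
  refine (Prog.runs_of_wp (P := .assign 7 (.var 4))
    (Q := fun s => s = s3.setVar 7 (s3.var 4)) rfl).seq ?_
  rintro s4 rfl
  have hin4 : HasInput r c (s3.setVar 7 (s3.var 4)) := hasInput_setVar hin3 (by omega)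
  have hp := sc1.le
  have hq := sc3.le
  have h6 : (s3.setVar 7 (s3.var 4)).var 6 = p := by
    simp [v3 6 (by simp) (by simp) (by simp), h1]
  have h7 : (s3.setVar 7 (s3.var 4)).var 7 = q := by simp [h3]
  refine (walk_runs (p := p) (q := q) (w := fun k => (k : ℤ)) reads_fwd_zero reads_fwd_one
    (by omega) (by omega) (fun s _ i j hi hj => by simp [Expr.eval, hi, hj])
    (by simp [Expr.cost]) Nat.cast_injective hin4 h6 h7).mono (by omega) ?_
  rintro s5 ⟨v5, a5, -, out⟩
  refine ⟨p, q, _, _, hin4.of_eq (v5 0 (by simp) (by simp)) (v5 1 (by simp) (by simp))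
    (a5 0 (by simp)) (a5 1 (by simp)), hp, hq, sc1.min, sc3.min, ?_, sc3.isClimb,
    (v5 6 (by simp) (by simp)).trans h6, (v5 7 (by simp) (by simp)).trans h7, out⟩
  have : s3.arr 3 = s1.arr 3 := a3 3 (by simp)
  simp only [State.setVar_arr, this]
  exact sc1.isClimb

lemma backward_runs (hr : r ≠ []) (hc : c ≠ []) {p q : ℕ} {D E : ℕ → ℤ} {s : State}
    (h : Halfway r c p q D E s) : Runs backward s (700 * (r.length + c.length)) fun s' =>
      ∃ D' E', IsClimb (fun x => r.getD (r.length - 1 - x) 0) (r.length - 1 - p) D' ∧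
        IsClimb (fun y => c.getD (c.length - 1 - y) 0) (c.length - 1 - q) E' ∧
        Outputs s' (domMerge r c D E D' E' p q) := by
  have hr' := List.length_pos_iff.2 hr
  have hc' := List.length_pos_iff.2 hc
  have hp := h.hp
  have hq := h.hq
  have hin := h.hasInput
  refine Runs.mono (k := 200 * r.length + (200 * c.length + (12 +
    (200 * (r.length + c.length) + 6)))) ?_ (by omega) fun _ h => h
  refine (scan_runs reads_bwd_zero hr' (by omega) hin hin.var0 (by omega)).seq ?_
  rintro s1 ⟨v1, a1, l, g, h1, sc1⟩
  have hin1 : HasInput r c s1 := hin.of_eq (v1 0 (by simp) (by simp) (by simp))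
    (v1 1 (by simp) (by simp) (by simp)) (a1 0 (by simp)) (a1 1 (by simp))
  refine (scan_runs reads_bwd_one hc' (by omega) hin1 hin1.var1 (by omega)).seq ?_
  rintro s2 ⟨v2, a2, l', g', h2, sc2⟩
  have hin2 : HasInput r c s2 := hin1.of_eq (v2 0 (by simp) (by simp) (by simp))
    (v2 1 (by simp) (by simp) (by simp)) (a2 0 (by simp)) (a2 1 (by simp))
  have h6 : s2.var 6 = p := by
    rw [v2 6 (by simp) (by simp) (by simp), v1 6 (by simp) (by simp) (by simp), h.var6]
  have h7 : s2.var 7 = q := by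
    rw [v2 7 (by simp) (by simp) (by simp), v1 7 (by simp) (by simp) (by simp), h.var7]
  refine (Prog.runs_of_wp (Q := fun s => HasInput r c s ∧ s.arr = s2.arr ∧
    s.var 6 = (r.length - 1 - p : ℕ) ∧ s.var 7 = (c.length - 1 - q : ℕ)) ?_).seq ?_
  · refine ⟨hasInput_setVar (hasInput_setVar hin2 (by omega)) (by omega), rfl, ?_, ?_⟩
    · simp [Expr.eval, hin2.var0, h6]; omega
    · simp [Expr.eval, hin2.var1, h7]; omega
  rintro s3 ⟨hin3, a3, h6', h7'⟩
  -- The backward walk writes from the end of the output down to cell `p + q`, so only the cells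
  -- strictly below survive from the forward half.
  refine Runs.seq (Q := fun s4 => HasInput r c s4 ∧
    (∀ z : ℤ, z < p + q → s4.arr 2 z = s.arr 2 z) ∧
    ∀ k ≤ r.length - 1 - p + (c.length - 1 - q), s4.arr 2 (r.length + c.length - 2 - k) =
      r.getD (r.length - 1 - (greedyWalk (fun i => s3.arr 3 i) (fun j => s3.arr 4 j)
        (r.length - 1 - p) (c.length - 1 - q) k).1) 0 +
      c.getD (c.length - 1 - (greedyWalk (fun i => s3.arr 3 i) (fun j => s3.arr 4 j)
        (r.length - 1 - p) (c.length - 1 - q) k).2) 0) ?_ ?_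
  · refine (walk_runs (p := r.length - 1 - p) (q := c.length - 1 - q)
      (w := fun k => (r.length + c.length - 2 : ℤ) - k) reads_bwd_zero reads_bwd_one
      (by omega) (by omega) (fun s hs i j hi hj => by
        simp only [Expr.eval, hi, hj, hs.var0, hs.var1]; push_cast; ring)
      (by simp [Expr.cost]) (fun i j hij => by dsimp only at hij; omega) hin3 h6' h7').mono
        (by omega) ?_
    rintro s4 ⟨v4, a4, keep, out⟩
    refine ⟨hin3.of_eq (v4 0 (by simp) (by simp)) (v4 1 (by simp) (by simp))
      (a4 0 (by simp)) (a4 1 (by simp)), fun z hz => ?_, out⟩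
    rw [keep z fun k hk => by omega, a3, a2 2 (by simp), a1 2 (by simp)]
  rintro s4 ⟨hin4, keep, out⟩
  refine (Prog.runs_of_wp (Q := fun s => s = s4.setVar 2 (r.length + c.length - 1)) ?_).mono
    (by simp [Prog.bound, Expr.cost]) ?_
  · simp only [Prog.wp, Expr.eval, hin4.var0, hin4.var1]
  rintro s5 rfl
  refine ⟨fun i => s3.arr 3 i, fun j => s3.arr 4 j, ?_, ?_, ?_, fun k hk => ?_⟩
  · rw [a3, a2 3 (by simp)]
    refine sc1.isClimb_of_min (by omega) fun x hx => ?_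
    rw [Nat.sub_sub_self hp]
    exact h.hpmin _ (by omega)
  · rw [a3]
    refine sc2.isClimb_of_min (by omega) fun x hx => ?_
    rw [Nat.sub_sub_self hq]
    exact h.hqmin _ (by omega)
  · simp only [State.setVar_var, if_true, domMerge, List.length_map, List.length_range]
    omega
  · have hk' : k < r.length - 1 + (c.length - 1) + 1 := by
      simpa only [domMerge, List.length_map, List.length_range] using hk
    simp only [domMerge, List.getElem_map, List.getElem_range, State.setVar_arr]
    -- Cell `p + q` is written by both walks and now holds the backward entry; `domPath_of_ge`
    -- includes this index.
    rcases lt_or_ge k (p + q) with hkp | hkp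
    · rw [keep k (by omega), h.out k hkp.le, domPath, if_pos hkp.le]
    · have := out (r.length - 1 + (c.length - 1) - k) (by omega)
      rw [show (r.length : ℤ) + c.length - 2 - (r.length - 1 + (c.length - 1) - k : ℕ) = k by
        omega] at this
      rw [this, domPath_of_ge hp hq hkp, mergeEntry]

end RAM

theorem lemma3p1 :
    ∃ (P : RAM.Prog) (K : ℕ), ∀ r c : List ℤ, r ≠ [] → c ≠ [] →
      ∃ t : List ℤ,
        (t ∈ merges r c ∧ t ∈ nonDiagMerges r c ∧ ∀ q ∈ merges r c, Dominates t q) ∧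
        ∃ (k : ℕ) (s : RAM.State), RAM.Exec P (RAM.input r c) k s ∧ RAM.Outputs s t ∧
          k ≤ K * (r.length + c.length) := by
  -- The constant is the sum of `500` for the forward half and `700` for the backward half.
  refine ⟨.seq RAM.forward RAM.backward, 1200, fun r c hr hc => ?_⟩
  obtain ⟨k, hk, s, hex, p, q, D, E, h⟩ := RAM.forward_runs hr hc
  obtain ⟨k', hk', s', hex', D', E', hD', hE', hout⟩ := RAM.backward_runs hr hc h
  exact ⟨domMerge r c D E D' E' p q,
    ⟨domMerge_mem_merges hr hc h.hp h.hq, domMerge_mem_nonDiagMerges hr hc h.hp h.hq,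
      fun _ => domMerge_dominates hr hc h.hp h.hq h.hpmin h.hqmin h.hD h.hE hD' hE'⟩,
    k + k', s', .seq hex hex', hout, by omega⟩
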